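/- All Banach spaces are real. Let $V$ be the $\mathbb{Q}$-vector space of finitely supported sequences of rational numbers, and let $\mathcal{P}\subseteq\mathbb{R}^V$ be the space of all pseudonorms on $V$ (functions $\mu\ge 0$ with $\mu(v+w)\le\mu(v)+\mu(w)$ and $\mu(qv)=|q|\mu(v)$ for $q\in\mathbb{Q}$), with the topology inherited from the product $\mathbb{R}^V$. Every $\mu\in\mathcal{P}$ extends uniquely to a pseudonorm, again denoted $\mu$, on the real vector space $c_{00}$ of finitely supported real sequences; let $X_\mu$ be the completion of $(c_{00},\mu)/\{x:\mu(x)=0\}$. Let $\mathcal{P}_\infty$ be the set of those $\mu\in\mathcal{P}$ for which $X_\mu$ is infinite-dimensional, and $\mathcal{B}$ the set of those $\mu\in\mathcal{P}_\infty$ whose extension to $c_{00}$ is a norm, both with the subspace topology. For a separable Banach space $Z$ and $\mathcal{I}\in\{\mathcal{P}_\infty,\mathcal{B}\}$, the isometry class of $Z$ in $\mathcal{I}$ is the set of those $\mu\in\mathcal{I}$ for which $X_\mu$ is linearly isometric to $Z$. A separable Banach space is isometrically universal if it contains a linearly isometric copy of every separable Banach space. A subset $A$ of a topological space $Y$ is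 $G_\delta$-complete if it is $G_\delta$ and for every zero-dimensional Polish space $T$ and every $G_\delta$ set $S\subseteq T$ there is a continuous $f:T\to Y$ with $f^{-1}(A)=S$. The Gurari\u{\i} space is a separable Banach space $\mathbb{G}$ such that for every $\varepsilon>0$, every finite-dimensional Banach space $F$, every subspace $A\subseteq\mathbb{G}$ and every linear isometric embedding $g:A\to F$ there is a linear map $f:F\to\mathbb{G}$ with $(1+\varepsilon)^{-1}\|x\|\le\|f(x)\|\le(1+\varepsilon)\|x\|$ for all $x\in F$ and $\|f\circ g-\mathrm{id}_A\|\le\varepsilon$. Such a space $\mathbb{G}$ exists, and for every such $\mathbb{G}$ the following hold. 1. $\mathbb{G}$ is isometrically universal, and its isometry class is $G_\delta$ in $\mathcal{B}$ and in $\mathcal{P}_\infty$. 2. $\mathbb{G}$ is the only such space: if $Z$ is an isometrically universal separable Banach space whose isometry class is $G_\delta$ in $\mathcal{B}$, then $Z$ is linearly isometric to $\mathbb{G}$. The same holds if $\mathcal{B}$ is replaced by $\mathcal{P}_\infty$. 3. The isometry class of $\mathbb{G}$ is $G_\delta$-complete in both $\mathcal{B}$ and $\mathcal{P}_\infty$.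 -/

import Mathlib

namespace BanachCoding

open TopologicalSpace

/-- The vector space `V` over `ℚ` of all finitely supported sequences of rational numbers. -/
abbrev V : Type := ℕ →₀ ℚ

/-- The vector space `c₀₀` over `ℝ` of all finitely supported sequences of real numbers. -/
abbrev C00 : Type := ℕ →₀ ℝ

/-- The inclusion of `V` into `c₀₀`. -/
noncomputable def castV : V →+ C00 :=
  Finsupp.mapRange.addMonoidHom (Rat.castHom ℝ).toAddMonoidHom

/-- The space `𝓟` of all pseudonorms on the rational vector space `V`. -/
def Pseudonorm : Type := Seminorm ℚ V

instance : FunLike Pseudonorm V ℝ := inferInstanceAs (FunLike (Seminorm ℚ V) V ℝ)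

instance : SeminormClass Pseudonorm ℚ V := inferInstanceAs (SeminormClass (Seminorm ℚ V) ℚ V)

/-- The topology of `𝓟` is the one inherited from the product `ℝ ^ V`. -/
instance : TopologicalSpace Pseudonorm :=
  TopologicalSpace.induced (fun (μ : Pseudonorm) (v : V) => μ v) Pi.topologicalSpace

/-! ### The extension of a pseudonorm from `V` to `c₀₀` -/

/-- The weighted `ℓ₁`-pseudonorm `∑ i, |x i| * μ (e i)` on `c₀₀`. -/
noncomputable def weight (μ : Pseudonorm) (x : C00) : ℝ :=
  x.sum fun i r => |r| * μ (Finsupp.single i 1)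

theorem weight_nonneg (μ : Pseudonorm) (x : C00) : 0 ≤ weight μ x :=
  Finset.sum_nonneg fun _ _ => mul_nonneg (abs_nonneg _) (apply_nonneg _ _)

theorem weight_add (μ : Pseudonorm) (x y : C00) :
    weight μ (x + y) ≤ weight μ x + weight μ y := by
  classical
  have h0 : ∀ i ∈ x.support ∪ y.support, |(0 : ℝ)| * μ (Finsupp.single i 1) = 0 := by simp
  unfold weight
  rw [Finsupp.sum_of_support_subset (x + y) Finsupp.support_add _ h0,
    Finsupp.sum_of_support_subset x Finset.subset_union_left _ h0,
    Finsupp.sum_of_support_subset y Finset.subset_union_right _ h0, ← Finset.sum_add_distrib]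
  refine Finset.sum_le_sum fun i _ => ?_
  rw [← add_mul]
  exact mul_le_mul_of_nonneg_right (abs_add_le _ _) (apply_nonneg _ _)

theorem weight_smul (μ : Pseudonorm) (c : ℝ) (x : C00) :
    weight μ (c • x) = |c| * weight μ x := by
  unfold weight
  rw [Finsupp.sum_smul_index' (by simp), Finsupp.sum, Finsupp.sum, Finset.mul_sum]
  refine Finset.sum_congr rfl fun i _ => ?_
  rw [smul_eq_mul, abs_mul, mul_assoc]

theorem le_weight (μ : Pseudonorm) (v : V) : μ v ≤ weight μ (castV v) := by
  have hw : weight μ (castV v) = v.sum fun i q => |(q : ℝ)| * μ (Finsupp.single i 1) := by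
    unfold weight castV
    exact Finsupp.sum_mapRange_index (hf := map_zero _) (by simp)
  rw [hw]
  conv_lhs => rw [← Finsupp.sum_single v]
  unfold Finsupp.sum
  refine (Finset.le_sum_of_subadditive μ (le_of_eq (map_zero μ)) (map_add_le_add μ) _ _).trans (Finset.sum_le_sum fun i _ => le_of_eq ?_)
  have : (Finsupp.single i (v i) : V) = v i • Finsupp.single i 1 := by simp
  rw [this, map_smul_eq_mul]
  rfl

theorem exists_weight_lt (μ : Pseudonorm) (x : C00) :
    ∀ ε : ℝ, 0 < ε → ∃ v : V, weight μ (x - castV v) < ε := by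
  induction x using Finsupp.induction_linear with
  | zero => exact fun ε hε => ⟨0, by simpa [weight] using hε⟩
  | add x y hx hy =>
    intro ε hε
    obtain ⟨v, hv⟩ := hx (ε / 2) (half_pos hε)
    obtain ⟨w, hw⟩ := hy (ε / 2) (half_pos hε)
    refine ⟨v + w, ?_⟩
    have : x + y - castV (v + w) = (x - castV v) + (y - castV w) := by
      rw [map_add]; abel
    rw [this]
    linarith [weight_add μ (x - castV v) (y - castV w)]
  | single i r =>
    intro ε hε
    have hm : 0 ≤ μ (Finsupp.single i 1) := apply_nonneg _ _
    obtain ⟨q, hq⟩ := exists_rat_near r (div_pos hε (by linarith : 0 < μ (Finsupp.single i 1) + 1))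
    refine ⟨Finsupp.single i q, ?_⟩
    have : (Finsupp.single i r : C00) - castV (Finsupp.single i q)
        = Finsupp.single i (r - (q : ℝ)) := by
      simp [castV, Finsupp.single_sub]
    rw [this, weight, Finsupp.sum_single_index (by simp)]
    rw [lt_div_iff₀ (by linarith)] at hq
    nlinarith [abs_nonneg (r - (q : ℝ))]

theorem extend_bddBelow (μ : Pseudonorm) (x : C00) :
    BddBelow (Set.range fun v : V => μ v + weight μ (x - castV v)) :=
  ⟨0, by rintro _ ⟨v, rfl⟩; exact add_nonneg (apply_nonneg _ _) (weight_nonneg _ _)⟩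

/-- The extension of a pseudonorm on `V` to a pseudonorm on the real vector space `c₀₀`;
`extend_castV` and `extend_unique` show that it is the only one. -/
noncomputable def extend (μ : Pseudonorm) : Seminorm ℝ C00 :=
  Seminorm.ofSMulLE (fun x => ⨅ v : V, (μ v + weight μ (x - castV v)))
    (by
      refine le_antisymm ?_ (le_ciInf fun v => add_nonneg (apply_nonneg _ _) (weight_nonneg _ _))
      refine (ciInf_le (extend_bddBelow μ 0) 0).trans (le_of_eq ?_)
      simp [weight])
    (fun x y => by
      refine le_ciInf_add_ciInf fun v w => ?_
      refine (ciInf_le (extend_bddBelow μ (x + y)) (v + w)).trans ?_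
      have h : x + y - castV (v + w) = (x - castV v) + (y - castV w) := by
        rw [map_add]; abel
      rw [h]
      linarith [weight_add μ (x - castV v) (y - castV w), map_add_le_add μ v w])
    (fun c x => by
      rw [Real.mul_iInf_of_nonneg (norm_nonneg c)]
      refine le_ciInf fun v => le_of_forall_pos_le_add fun ε hε => ?_
      have hpos : 0 < μ v + weight μ (castV v) + 1 := by
        linarith [weight_nonneg μ (castV v), apply_nonneg μ v]
      obtain ⟨q, hq⟩ := exists_rat_near c (div_pos hε hpos)
      rw [lt_div_iff₀ hpos] at hq
      refine (ciInf_le (extend_bddBelow μ (c • x)) (q • v)).trans ?_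
      have hc : castV (q • v) = (q : ℝ) • castV v := by
        ext i; simp [castV]
      have h : c • x - castV (q • v) = c • (x - castV v) + (c - (q : ℝ)) • castV v := by
        rw [hc, smul_sub, sub_smul]; abel
      have h1 := weight_add μ (c • (x - castV v)) ((c - (q : ℝ)) • castV v)
      rw [weight_smul, weight_smul] at h1
      have h2 : |(q : ℝ)| ≤ |c| + |c - q| := by
        have := abs_sub_abs_le_abs_sub (q : ℝ) c
        rw [abs_sub_comm] at this
        linarith
      have h3 : μ (q • v) = |(q : ℝ)| * μ v := map_smul_eq_mul μ q v
      have h4 := mul_le_mul_of_nonneg_right h2 (apply_nonneg μ v)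
      rw [h, h3, Real.norm_eq_abs]
      nlinarith [abs_nonneg (c - (q : ℝ))])

theorem extend_apply (μ : Pseudonorm) (x : C00) :
    extend μ x = ⨅ v : V, (μ v + weight μ (x - castV v)) := rfl

theorem extend_castV (μ : Pseudonorm) (v : V) : extend μ (castV v) = μ v := by
  rw [extend_apply]
  refine le_antisymm ((ciInf_le (extend_bddBelow μ _) v).trans (by simp [weight]))
    (le_ciInf fun w => ?_)
  have h1 := le_weight μ (v - w)
  rw [castV.map_sub] at h1
  have h2 := map_add_le_add μ w (v - w)
  rw [add_sub_cancel] at h2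
  linarith

theorem extend_unique (μ : Pseudonorm) (p : Seminorm ℝ C00) (hp : ∀ v : V, p (castV v) = μ v) :
    p = extend μ := by
  have key : ∀ p : Seminorm ℝ C00, (∀ v : V, p (castV v) = μ v) → ∀ x, p x ≤ weight μ x := by
    intro p hp x
    conv_lhs => rw [← Finsupp.sum_single x]
    unfold weight Finsupp.sum
    refine (Finset.le_sum_of_subadditive p (le_of_eq (map_zero p)) (map_add_le_add p) _ _).trans (Finset.sum_le_sum fun i _ => le_of_eq ?_)
    have h1 : (Finsupp.single i (x i) : C00) = x i • castV (Finsupp.single i 1) := by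
      simp [castV]
    rw [h1, map_smul_eq_mul, hp, Real.norm_eq_abs]
  have main : ∀ p q : Seminorm ℝ C00, (∀ v : V, p (castV v) = μ v) →
      (∀ v : V, q (castV v) = μ v) → ∀ x, p x ≤ q x := by
    intro p q hp hq x
    refine le_of_forall_pos_le_add fun ε hε => ?_
    obtain ⟨v, hv⟩ := exists_weight_lt μ x (ε / 2) (half_pos hε)
    have h1 := map_add_le_add p (x - castV v) (castV v)
    have h2 := map_sub_le_add q x (x - castV v)
    rw [sub_add_cancel] at h1
    rw [sub_sub_cancel] at h2
    rw [hp] at h1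
    rw [hq] at h2
    linarith [key p hp (x - castV v), key q hq (x - castV v)]
  ext x
  exact le_antisymm (main p _ hp (extend_castV μ) x) (main _ p (extend_castV μ) hp x)

/-! ### The coded Banach spaces and the spaces of codes -/

/-- The space `c₀₀` seminormed by (the extension of) `μ`. -/
def PreSpace (_μ : Pseudonorm) : Type := C00

noncomputable instance (μ : Pseudonorm) : AddCommGroup (PreSpace μ) := inferInstanceAs (AddCommGroup C00)

noncomputable instance (μ : Pseudonorm) : Module ℝ (PreSpace μ) := inferInstanceAs (Module ℝ C00)

noncomputable instance (μ : Pseudonorm) : SeminormedAddCommGroup (PreSpace μ) :=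
  (extend μ).toAddGroupSeminorm.toSeminormedAddCommGroup

noncomputable instance (μ : Pseudonorm) : NormedSpace ℝ (PreSpace μ) where
  __ := (inferInstance : Module ℝ (PreSpace μ))
  norm_smul_le c x := le_of_eq (map_smul_eq_mul (extend μ) c x)

/-- The Banach space `X_μ`: the Hausdorff completion of `(c₀₀, μ)`, that is, the completion of
its quotient by `{x | μ x = 0}`. -/
abbrev X (μ : Pseudonorm) : Type := UniformSpace.Completion (PreSpace μ)

/-- The set `𝓟_∞` of the pseudonorms `μ` for which `X_μ` is infinite-dimensional. -/
def PInf : Set Pseudonorm := {μ | ¬ FiniteDimensional ℝ (X μ)}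

/-- The set `𝓑` of those `μ` in `𝓟_∞` whose extension to `c₀₀` is a norm. -/
def B : Set Pseudonorm := {μ | μ ∈ PInf ∧ ∀ x : C00, extend μ x = 0 → x = 0}

/-- The isometry class of `Z` in `I`: all codes in `I` of spaces linearly isometric to `Z`. It is a
subset of the topological space `I`, which carries the subspace topology. -/
def isometryClass (I : Set Pseudonorm) (Z : Type*) [NormedAddCommGroup Z] [NormedSpace ℝ Z] :
    Set I :=
  {μ | Nonempty (X μ.1 ≃ₗᵢ[ℝ] Z)}

/-! ### Properties of Banach spaces -/

/-- `Z` contains a linearly isometric copy of every separable Banach space. (Every separable Banach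
space is linearly isometric to one whose underlying type lives in `Type`.) -/
def IsometricallyUniversal (Z : Type*) [NormedAddCommGroup Z] [NormedSpace ℝ Z] : Prop :=
  ∀ (Y : Type) [NormedAddCommGroup Y] [NormedSpace ℝ Y] [CompleteSpace Y] [SeparableSpace Y],
    Nonempty (Y →ₗᵢ[ℝ] Z)

/-- The property that defines the Gurariĭ space among the separable Banach spaces: for all `ε > 0`
and all linear isometric embeddings `g : A → F` of a subspace `A` of `G` into a finite-dimensional
space `F` there is a `(1 + ε)`-isomorphism `f : F → G` with `‖f ∘ g - id_A‖ ≤ ε`. (Every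
finite-dimensional space is linearly isometric to one whose underlying type lives in `Type`.) -/
def IsGurarii (G : Type*) [NormedAddCommGroup G] [NormedSpace ℝ G] : Prop :=
  ∀ ε : ℝ, 0 < ε → ∀ (F : Type) [NormedAddCommGroup F] [NormedSpace ℝ F] [FiniteDimensional ℝ F]
    (A : Submodule ℝ G) (g : A →ₗᵢ[ℝ] F), ∃ f : F →ₗ[ℝ] G,
      (∀ x : F, (1 + ε)⁻¹ * ‖x‖ ≤ ‖f x‖ ∧ ‖f x‖ ≤ (1 + ε) * ‖x‖) ∧
      ∀ a : A, ‖f (g a) - (a : G)‖ ≤ ε * ‖a‖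

/-! ### Completeness of sets for the class `G_δ` -/

/-- `A` is `G_δ`-hard: every `G_δ` subset of a zero-dimensional Polish space is the preimage of `A`
under a continuous map. (Every Polish space is homeomorphic to one that lives in `Type`.) -/
def IsGδHard {Y : Type*} [TopologicalSpace Y] (A : Set Y) : Prop :=
  ∀ (T : Type) [TopologicalSpace T] [PolishSpace T],
    IsTopologicalBasis {U : Set T | IsClopen U} →
    ∀ S : Set T, IsGδ S → ∃ f : T → Y, Continuous f ∧ f ⁻¹' A = S

/-- `A` is `G_δ`-complete: it is `G_δ` and `G_δ`-hard. -/
def IsGδComplete {Y : Type*} [TopologicalSpace Y] (A : Set Y) : Prop :=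
  IsGδ A ∧ IsGδHard A

end BanachCoding

/-! The proof combines amalgamation of seminorms with Baire category. Two seminormed spaces that
share a subspace up to a small error sit isometrically in a common one (`glue`).

Universality and uniqueness of the Gurariĭ space: the seminorms on `Y × G` extending both norms form
a compact space `Joint Y G`, and `φ (y, -g)` is the distance between `y` and `g` in the amalgam. The
Gurariĭ property of `G` makes "`y` is within `ε` of `G`" a dense open condition on `φ`
(`Joint.dense_near`). If `Y` is separable, a generic `φ` therefore glues every `y` to a vector of
`G`, which is an isometric embedding. If both spaces are separable Gurariĭ spaces, the symmetric
conditions are generic as well and the embedding is onto.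

Existence and complexity: `X μ` is Gurariĭ iff `μ` lies in countably many sets `Realizing`
(`gurarii_codes_eq`), each saying that all bounded pseudonorms `ν` agreeing with `μ` on `V_n` are
approximately realized over `V_n` inside `μ`. These sets are open, because bounded pseudonorms form
a compact set, and dense, because a finite net of such `ν` can be amalgamated with `μ` beyond any
given coordinate. Hence the Gurariĭ codes form a dense `G_δ` set in the Polish space `𝓟`.

Uniqueness among universal spaces: the codes in `𝓑` of a universal `Z` are dense
(`IsometricallyUniversal.dense_codes`), since every code is close to a norm, which embeds in `Z`,
and only finitely many basis vectors have to be kept. If the class of `Z` is `G_δ` in `𝓑`, it is the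
trace of a dense `G_δ` set, which must meet the dense `G_δ` set of Gurariĭ codes in `𝓑`.

Completeness: non-Gurariĭ codes are dense too, as a slight perturbation creates an `ℓ₁`-summand. A
dense `G_δ` set whose complement is dense is `G_δ`-hard by successive approximation
(`exists_continuous_reduction`). -/

namespace BanachCoding

open TopologicalSpace Filter Topology

universe u v w

/-! ### Amalgamation of seminorms -/

section Glue

variable {E₁ E₂ W : Type*} [AddCommGroup E₁] [Module ℝ E₁] [AddCommGroup E₂] [Module ℝ E₂]
  [AddCommGroup W] [Module ℝ W]

/-- The amalgam of the seminorms `p` and `q` along the maps `i` and `j`, where `i w` and `j w` are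
identified up to the error `r w`. -/
noncomputable def glue (p : Seminorm ℝ E₁) (q : Seminorm ℝ E₂) (i : W →ₗ[ℝ] E₁) (j : W →ₗ[ℝ] E₂)
    (r : Seminorm ℝ W) : Seminorm ℝ (E₁ × E₂) :=
  Seminorm.ofSMulLE (fun x => ⨅ w : W, (p (x.1 - i w) + q (x.2 + j w) + r w))
    (by
      refine le_antisymm ?_ (le_ciInf fun w => by positivity)
      refine (ciInf_le ⟨0, by rintro _ ⟨w, rfl⟩; positivity⟩ 0).trans (le_of_eq ?_)
      simp)
    (fun x y => by
      refine le_ciInf_add_ciInf fun v w => ?_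
      refine (ciInf_le ⟨0, by rintro _ ⟨w, rfl⟩; positivity⟩ (v + w)).trans ?_
      have h1 : (x + y).1 - i (v + w) = (x.1 - i v) + (y.1 - i w) := by
        rw [map_add, Prod.fst_add]; abel
      have h2 : (x + y).2 + j (v + w) = (x.2 + j v) + (y.2 + j w) := by
        rw [map_add, Prod.snd_add]; abel
      rw [h1, h2]
      linarith [map_add_le_add p (x.1 - i v) (y.1 - i w),
        map_add_le_add q (x.2 + j v) (y.2 + j w), map_add_le_add r v w])
    (fun c x => by
      rw [Real.mul_iInf_of_nonneg (norm_nonneg c)]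
      refine le_ciInf fun w => ?_
      refine (ciInf_le ⟨0, by rintro _ ⟨w, rfl⟩; positivity⟩ (c • w)).trans (le_of_eq ?_)
      rw [map_smul, map_smul, Prod.smul_fst, Prod.smul_snd, ← smul_sub, ← smul_add,
        map_smul_eq_mul, map_smul_eq_mul, map_smul_eq_mul]
      ring)

variable {p : Seminorm ℝ E₁} {q : Seminorm ℝ E₂} {i : W →ₗ[ℝ] E₁} {j : W →ₗ[ℝ] E₂}
  {r : Seminorm ℝ W}

theorem glue_le (x : E₁) (y : E₂) (w : W) :
    glue p q i j r (x, y) ≤ p (x - i w) + q (y + j w) + r w :=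
  ciInf_le (f := fun w : W => p (x - i w) + q (y + j w) + r w)
    ⟨0, by rintro _ ⟨w, rfl⟩; positivity⟩ w

theorem le_glue {c : ℝ} {x : E₁} {y : E₂} (h : ∀ w, c ≤ p (x - i w) + q (y + j w) + r w) :
    c ≤ glue p q i j r (x, y) :=
  le_ciInf h

theorem glue_inl (h : ∀ w, p (i w) ≤ q (j w) + r w) (x : E₁) :
    glue p q i j r (x, 0) = p x := by
  refine le_antisymm ((glue_le x 0 0).trans (by simp)) (le_glue fun w => ?_)
  have := map_add_le_add p (x - i w) (i w)
  rw [sub_add_cancel] at this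
  rw [zero_add]
  linarith [h w]

theorem glue_inr (h : ∀ w, q (j w) ≤ p (i w) + r w) (y : E₂) :
    glue p q i j r (0, y) = q y := by
  refine le_antisymm ((glue_le 0 y 0).trans (by simp)) (le_glue fun w => ?_)
  have := map_sub_le_add q (y + j w) (j w)
  rw [add_sub_cancel_right] at this
  rw [zero_sub, map_neg_eq_map]
  linarith [h w]

theorem glue_diag_le (w : W) : glue p q i j r (i w, -j w) ≤ r w :=
  (glue_le _ _ w).trans (by simp)

end Glue

/-! ### The Gurariĭ property for seminorms -/

section Gurarii

/-- The carrier `F` is kept abstract so that the norm given by `q` does not compete with the sup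
norm of `Fin n → ℝ`. -/
theorem exists_normed_of_addGroupNorm {E : Type u} [AddCommGroup E] [Module ℝ E]
    (p : Seminorm ℝ E) {F : Type} [AddCommGroup F] [Module ℝ F] [FiniteDimensional ℝ F]
    (q : AddGroupNorm F) (hq : ∀ (c : ℝ) x, q (c • x) = |c| * q x) (π : E →ₗ[ℝ] F)
    (hπ : ∀ x, q (π x) = p x) :
    ∃ (F : Type) (_ : NormedAddCommGroup F) (_ : NormedSpace ℝ F)
      (π : E →ₗ[ℝ] F), FiniteDimensional ℝ F ∧ ∀ x, ‖π x‖ = p x := by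
  let G : NormedAddCommGroup F := q.toNormedAddCommGroup
  let S : NormedSpace ℝ F := { norm_smul_le := fun c x => le_of_eq (hq c x) }
  exact ⟨F, G, S, π, ‹_›, hπ⟩

/-- Every finite-dimensional seminormed space maps onto a normed space in `Type` by a linear map
that preserves the seminorm. -/
theorem exists_normed_model {E : Type u} [AddCommGroup E] [Module ℝ E] [FiniteDimensional ℝ E]
    (p : Seminorm ℝ E) : ∃ (F : Type) (_ : NormedAddCommGroup F) (_ : NormedSpace ℝ F)
      (π : E →ₗ[ℝ] F), FiniteDimensional ℝ F ∧ ∀ x, ‖π x‖ = p x := by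
  let N : Submodule ℝ E :=
    { carrier := {x | p x = 0}
      add_mem' := fun {a b} ha hb => le_antisymm
        ((map_add_le_add p a b).trans (by
          rw [Set.mem_ofPred_eq] at ha hb
          rw [ha, hb, add_zero])) (apply_nonneg _ _)
      zero_mem' := map_zero p
      smul_mem' := fun c x hx => by
        rw [Set.mem_ofPred_eq] at hx ⊢
        rw [map_smul_eq_mul, hx, mul_zero] }
  have hN : ∀ x, x ∈ N ↔ p x = 0 := fun x => Iff.rfl
  let b := Module.finBasis ℝ (E ⧸ N)
  let n := Module.finrank ℝ (E ⧸ N)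
  let π : E →ₗ[ℝ] (Fin n → ℝ) := b.equivFun.toLinearMap ∘ₗ N.mkQ
  have hπ : ∀ x, π x = 0 ↔ p x = 0 := fun x => by simp [π, hN]
  have hs : LinearMap.range π = ⊤ := by
    rw [LinearMap.range_eq_top]
    exact b.equivFun.surjective.comp N.mkQ_surjective
  obtain ⟨σ, hσ⟩ := LinearMap.exists_rightInverse_of_surjective π hs
  have hσ' : ∀ y, π (σ y) = y := fun y => LinearMap.congr_fun hσ y
  let q : AddGroupNorm (Fin n → ℝ) :=
    { (p.comp σ).toAddGroupSeminorm with
      eq_zero_of_map_eq_zero' := fun y hy => by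
        rw [← hσ' y, hπ]
        exact hy }
  refine exists_normed_of_addGroupNorm p q (fun c x => map_smul_eq_mul (p.comp σ) c x) π
    fun x => ?_
  change p (σ (π x)) = p x
  have h : p (σ (π x) - x) = 0 := by
    rw [← hπ, map_sub, hσ', sub_self]
  have := abs_sub_map_le_sub p (σ (π x)) x
  rw [h] at this
  linarith [abs_nonpos_iff.1 this]

variable {G : Type v} [NormedAddCommGroup G] [NormedSpace ℝ G]

/-- The defining property of the Gurariĭ space for seminorms on finite-dimensional spaces of any
universe. -/
theorem IsGurarii.exists_almost_isometry (hG : IsGurarii G) {E : Type u} [AddCommGroup E]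
    [Module ℝ E] [FiniteDimensional ℝ E] (p : Seminorm ℝ E) {W : Type w} [AddCommGroup W]
    [Module ℝ W] (i : W →ₗ[ℝ] E) (j : W →ₗ[ℝ] G) (hij : ∀ w, p (i w) = ‖j w‖) {ε : ℝ}
    (hε : 0 < ε) : ∃ f : E →ₗ[ℝ] G,
      (∀ x, (1 + ε)⁻¹ * p x ≤ ‖f x‖ ∧ ‖f x‖ ≤ (1 + ε) * p x) ∧
      ∀ w, ‖f (i w) - j w‖ ≤ ε * ‖j w‖ := by
  obtain ⟨F, _, _, π, _, hπ⟩ := exists_normed_model p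
  obtain ⟨s, hs⟩ := LinearMap.exists_rightInverse_of_surjective j.rangeRestrict
    (LinearMap.range_rangeRestrict j)
  have hs' : ∀ a : LinearMap.range j, j (s a) = a := fun a =>
    congrArg Subtype.val (LinearMap.congr_fun hs a)
  -- The choice of the section `s` is immaterial: if `j w = j w'`, then `p (i (w - w')) = 0`, so `π`
  -- identifies `i w` and `i w'`.
  let g : LinearMap.range j →ₗᵢ[ℝ] F :=
    { (π ∘ₗ i ∘ₗ s) with
      norm_map' := fun a => by
        change ‖π (i (s a))‖ = ‖a‖
        rw [hπ, hij, hs']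
        rfl }
  have hg : ∀ w, g (j.rangeRestrict w) = π (i w) := fun w => by
    change π (i (s (j.rangeRestrict w))) = π (i w)
    rw [← sub_eq_zero, ← map_sub, ← map_sub, ← norm_eq_zero, hπ, hij, map_sub, hs']
    simp
  obtain ⟨f, hf, hfg⟩ := hG ε hε F (LinearMap.range j) g
  refine ⟨f ∘ₗ π, fun x => ?_, fun w => ?_⟩
  · rw [← hπ]
    exact hf (π x)
  · have := hfg (j.rangeRestrict w)
    rw [hg] at this
    exact this

theorem IsGurarii.of_equiv (hG : IsGurarii G) {H : Type w} [NormedAddCommGroup H]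
    [NormedSpace ℝ H] (e : G ≃ₗᵢ[ℝ] H) : IsGurarii H := by
  intro ε hε F _ _ _ A g
  obtain ⟨f, hf, hfg⟩ := hG.exists_almost_isometry (normSeminorm ℝ F) g.toLinearMap
    (e.symm.toLinearEquiv.toLinearMap ∘ₗ A.subtype) (fun w => by simp) hε
  refine ⟨e.toLinearEquiv.toLinearMap ∘ₗ f, fun x => by simpa using hf x, fun a => ?_⟩
  have := hfg a
  have h : e (f (g a)) - (a : H) = e (f (g a) - e.symm a) := by simp
  simp only [LinearMap.comp_apply]
  change ‖e (f (g a)) - (a : H)‖ ≤ _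
  rw [h, e.norm_map]
  simpa using this

end Gurarii

theorem abs_sub_le_of_almost_eq {δ a b : ℝ} (hδ : 0 < δ) (ha : 0 ≤ a)
    (h : (1 + δ)⁻¹ * a ≤ b ∧ b ≤ (1 + δ) * a) : |b - a| ≤ δ * a := by
  have h3 : 1 - δ ≤ (1 + δ)⁻¹ := by
    rw [← one_div, le_div_iff₀ (by positivity)]
    nlinarith
  rw [abs_le]
  constructor
  · nlinarith [mul_le_mul_of_nonneg_right h3 ha]
  · linarith [h.2]

/-! ### The compact space of joint seminorms -/

section Joint

variable (Y : Type u) [NormedAddCommGroup Y] [NormedSpace ℝ Y]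
  (G : Type v) [NormedAddCommGroup G] [NormedSpace ℝ G]

/-- The seminorms on `Y × G` that extend the norms of `Y` and `G`. -/
def Joint : Set (Y × G → ℝ) :=
  {φ | (∀ x y, φ (x + y) ≤ φ x + φ y) ∧ (∀ (c : ℝ) x, φ (c • x) = |c| * φ x) ∧
    (∀ y, φ (y, 0) = ‖y‖) ∧ ∀ g, φ (0, g) = ‖g‖}

variable {Y G}

/-- The seminorm that belongs to an element of `Joint Y G`. -/
def Joint.seminorm (φ : Joint Y G) : Seminorm ℝ (Y × G) :=
  Seminorm.of φ.1 φ.2.1 φ.2.2.1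

theorem Joint.seminorm_apply (φ : Joint Y G) (x : Y × G) : Joint.seminorm φ x = φ.1 x := rfl

/-- The element of `Joint Y G` that belongs to a seminorm. -/
def Joint.mk (p : Seminorm ℝ (Y × G)) (h₁ : ∀ y, p (y, 0) = ‖y‖) (h₂ : ∀ g, p (0, g) = ‖g‖) :
    Joint Y G :=
  ⟨p, map_add_le_add p, map_smul_eq_mul p, h₁, h₂⟩

theorem isClosed_joint : IsClosed (Joint Y G) := by
  simp only [Joint, Set.ofPred_and, Set.ofPred_forall]
  refine IsClosed.inter ?_ (IsClosed.inter ?_ (IsClosed.inter ?_ ?_))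
  · exact isClosed_iInter fun x => isClosed_iInter fun y =>
      isClosed_le (by fun_prop) (by fun_prop)
  · exact isClosed_iInter fun c => isClosed_iInter fun x =>
      isClosed_eq (continuous_apply _) (continuous_const.mul (continuous_apply _))
  · exact isClosed_iInter fun y => isClosed_eq (continuous_apply _) continuous_const
  · exact isClosed_iInter fun y => isClosed_eq (continuous_apply _) continuous_const

/-- Subadditivity confines `φ x` to `[0, ‖x.1‖ + ‖x.2‖]`, so Tychonoff's theorem applies.
Compactness is what gives the Baire property here: the product over `Y × G` need not be metrizable.
-/
theorem isCompact_joint : IsCompact (Joint Y G) := by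
  refine (isCompact_univ_pi fun x : Y × G => isCompact_Icc (a := (0 : ℝ))
    (b := ‖x.1‖ + ‖x.2‖)).of_isClosed_subset isClosed_joint fun φ hφ x _ => ⟨?_, ?_⟩
  · exact apply_nonneg (Joint.seminorm ⟨φ, hφ⟩) x
  · have := hφ.1 (x.1, 0) (0, x.2)
    rw [hφ.2.2.1, hφ.2.2.2] at this
    simpa using this

instance : CompactSpace (Joint Y G) := isCompact_iff_compactSpace.1 isCompact_joint

instance : Nonempty (Joint Y G) :=
  ⟨Joint.mk ((normSeminorm ℝ Y).comp (LinearMap.fst ℝ Y G) +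
      (normSeminorm ℝ G).comp (LinearMap.snd ℝ Y G))
    (fun y => by simp) (fun g => by simp)⟩

/-- The seminorms for which `y` is at distance less than `ε` from a vector of `G`. -/
def Joint.near (G : Type v) [NormedAddCommGroup G] [NormedSpace ℝ G] (y : Y) (ε : ℝ) :
    Set (Joint Y G) :=
  {φ | ∃ g : G, φ.1 (y, -g) < ε}

theorem Joint.isOpen_near (y : Y) (ε : ℝ) : IsOpen (Joint.near G y ε) := by
  simp only [Joint.near, Set.ofPred_exists]
  exact isOpen_iUnion fun g =>
    isOpen_lt ((continuous_apply _).comp continuous_subtype_val) continuous_const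

/-- A set of functions is dense if each function can be approximated on each finite set. -/
theorem dense_of_approx {ι : Type*} {K : Type*} [TopologicalSpace K] (e : K → ι → ℝ)
    (he : IsInducing e) {D : Set K}
    (h : ∀ φ : K, ∀ s : Finset ι, ∀ ε : ℝ, 0 < ε → ∃ ψ ∈ D, ∀ i ∈ s, |e ψ i - e φ i| < ε) :
    Dense D := by
  intro φ
  rw [mem_closure_iff_nhds]
  intro U hU
  rw [he.nhds_eq_comap, mem_comap] at hU
  obtain ⟨t, ht, htU⟩ := hU
  rw [nhds_pi, Filter.mem_pi'] at ht
  obtain ⟨s, V, hV, hVt⟩ := ht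
  have : ∀ i, ∃ ε > 0, Metric.ball (e φ i) ε ⊆ V i := fun i => Metric.mem_nhds_iff.1 (hV i)
  choose ε hε hball using this
  obtain ⟨δ, hδ, hδε⟩ : ∃ δ > 0, ∀ i ∈ s, δ ≤ ε i := by
    rcases s.eq_empty_or_nonempty with rfl | hs
    · exact ⟨1, one_pos, by simp⟩
    · obtain ⟨i, _, hi⟩ := s.exists_min_image ε hs
      exact ⟨ε i, hε i, hi⟩
  obtain ⟨ψ, hψD, hψ⟩ := h φ s δ hδ
  refine ⟨ψ, htU (hVt fun i hi => hball i ?_), hψD⟩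
  rw [Metric.mem_ball, Real.dist_eq]
  exact (hψ i hi).trans_le (hδε i hi)

/-- Only the finite-dimensional parts `E ⊆ Y` and `A ⊆ G` carrying `y` and `s` matter. The Gurariĭ
property maps `E × A`, normed by `φ`, almost isometrically into `G`, almost fixing `A`. Gluing `Y`
to `G` along the restriction `h` to `E` moves `y` close to `h y`, and it changes `φ` little on `s`,
because `q (w, a) ≈ ‖a + h w‖ ≈ ‖f (w, a)‖ ≈ φ (w, a)`. -/
theorem Joint.dense_near (hG : IsGurarii G) (y : Y) {ε : ℝ} (hε : 0 < ε) :
    Dense (Joint.near G y ε) := by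
  refine dense_of_approx (fun φ : Joint Y G => φ.1) IsInducing.subtypeVal ?_
  intro φ s η hη
  let p := Joint.seminorm φ
  have hp₁ : ∀ y, p (y, 0) = ‖y‖ := φ.2.2.2.1
  have hp₂ : ∀ g, p (0, g) = ‖g‖ := φ.2.2.2.2
  classical
  let E : Submodule ℝ Y := Submodule.span ℝ ((insert y (s.image Prod.fst) : Finset Y) : Set Y)
  let A : Submodule ℝ G := Submodule.span ℝ ((s.image Prod.snd : Finset G) : Set G)
  have hyE : y ∈ E := Submodule.subset_span (by simp)
  have hE : ∀ x ∈ s, x.1 ∈ E := fun x hx => Submodule.subset_span (by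
    simp only [Finset.coe_insert, Finset.coe_image]
    exact Or.inr ⟨x, hx, rfl⟩)
  have hA : ∀ x ∈ s, x.2 ∈ A := fun x hx => Submodule.subset_span (by
    simp only [Finset.coe_image]
    exact ⟨x, hx, rfl⟩)
  let C : ℝ := ‖y‖ + ∑ x ∈ s, (‖x.1‖ + ‖x.2‖ + p x) + 1
  have hC : 0 < C := by
    have : 0 ≤ ∑ x ∈ s, (‖x.1‖ + ‖x.2‖ + p x) := Finset.sum_nonneg fun x _ => by positivity
    positivity
  have hCy : ‖y‖ ≤ C := by
    have : 0 ≤ ∑ x ∈ s, (‖x.1‖ + ‖x.2‖ + p x) := Finset.sum_nonneg fun x _ => by positivity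
    simp only [C]; linarith
  have hCs : ∀ x ∈ s, ‖x.1‖ + ‖x.2‖ + p x ≤ C := fun x hx => by
    have := Finset.single_le_sum (f := fun x : Y × G => ‖x.1‖ + ‖x.2‖ + p x)
      (fun x _ => by positivity) hx
    simp only [C]; linarith [norm_nonneg y]
  obtain ⟨δ, hδ, hδε, hδη⟩ : ∃ δ > 0, δ * C < ε ∧ δ * C < η :=
    ⟨min ε η / (2 * C), by positivity, by
      have : min ε η / (2 * C) * C = min ε η / 2 := by field_simp
      rw [this]; linarith [min_le_left ε η, lt_min hε hη], by
      have : min ε η / (2 * C) * C = min ε η / 2 := by field_simp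
      rw [this]; linarith [min_le_right ε η, lt_min hε hη]⟩
  let inc : (E × A) →ₗ[ℝ] (Y × G) := E.subtype.prodMap A.subtype
  obtain ⟨f, hf, hfj⟩ := hG.exists_almost_isometry (p.comp inc) (LinearMap.inr ℝ E A) A.subtype
    (fun w => by
      rw [Seminorm.comp_apply]
      exact hp₂ w) hδ
  have hf' : ∀ x, |‖f x‖ - p (inc x)| ≤ δ * p (inc x) := fun x =>
    abs_sub_le_of_almost_eq hδ (apply_nonneg _ _) (hf x)
  let h : E →ₗ[ℝ] G := f ∘ₗ LinearMap.inl ℝ E A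
  have hh : ∀ w : E, |‖h w‖ - ‖(w : Y)‖| ≤ δ * ‖(w : Y)‖ := fun w => by
    have := hf' (w, 0)
    have e : p (inc (w, 0)) = ‖(w : Y)‖ := hp₁ w
    rw [e] at this
    exact this
  -- `h` distorts norms by at most `δ * ‖w‖`; allowing exactly this error in the gluing leaves the
  -- norms of `Y` and `G` unchanged.
  let r : Seminorm ℝ E := δ.toNNReal • (normSeminorm ℝ Y).comp E.subtype
  have hr : ∀ w : E, r w = δ * ‖(w : Y)‖ := fun w => by
    change ((δ.toNNReal : NNReal) : ℝ) * ‖(w : Y)‖ = _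
    rw [Real.coe_toNNReal _ hδ.le]
  let q := glue (normSeminorm ℝ Y) (normSeminorm ℝ G) E.subtype h r
  have hq₁ : ∀ y, q (y, 0) = ‖y‖ := glue_inl fun w => by
    rw [hr]
    have := (abs_le.1 (hh w)).1
    simp only [coe_normSeminorm, Submodule.subtype_apply]
    linarith
  have hq₂ : ∀ g, q (0, g) = ‖g‖ := glue_inr fun w => by
    rw [hr]
    have := (abs_le.1 (hh w)).2
    simp only [coe_normSeminorm, Submodule.subtype_apply]
    linarith
  have hq₃ : ∀ w : E, q (w, -h w) ≤ δ * ‖(w : Y)‖ := fun w => hr w ▸ glue_diag_le w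
  refine ⟨Joint.mk q hq₁ hq₂, ⟨h ⟨y, hyE⟩, ?_⟩, fun x hx => ?_⟩
  · exact (hq₃ ⟨y, hyE⟩).trans_lt ((mul_le_mul_of_nonneg_left hCy hδ.le).trans_lt hδε)
  · change |q x - p x| < η
    let w : E := ⟨x.1, hE x hx⟩
    let a : A := ⟨x.2, hA x hx⟩
    have h1 : |q x - ‖(a : G) + h w‖| ≤ δ * ‖x.1‖ := by
      rw [← hq₂]
      refine (abs_sub_map_le_sub q _ _).trans ?_
      have : x - (0, (a : G) + h w) = ((w : Y), -h w) := by
        ext <;> simp [a, w]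
      rw [this]
      exact hq₃ w
    have h2 : |‖(a : G) + h w‖ - ‖f (w, a)‖| ≤ δ * ‖x.2‖ := by
      refine (abs_norm_sub_norm_le _ _).trans ?_
      have : (a : G) + h w - f (w, a) = -(f (0, a) - a) := by
        have : f (w, a) = h w + f (0, a) := by
          simp only [h, LinearMap.comp_apply, LinearMap.inl_apply, ← map_add, Prod.mk_add_mk,
            add_zero, zero_add]
        rw [this]; abel
      rw [this, norm_neg]
      exact hfj a
    have h3 : |‖f (w, a)‖ - p x| ≤ δ * p x := hf' (w, a)
    calc |q x - p x| ≤ |q x - ‖(a : G) + h w‖| + |‖(a : G) + h w‖ - ‖f (w, a)‖|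
          + |‖f (w, a)‖ - p x| := by
          have := abs_sub_le (q x) (‖(a : G) + h w‖) (p x)
          have := abs_sub_le (‖(a : G) + h w‖) ‖f (w, a)‖ (p x)
          linarith
      _ ≤ δ * (‖x.1‖ + ‖x.2‖ + p x) := by linarith
      _ ≤ δ * C := mul_le_mul_of_nonneg_left (hCs x hx) hδ.le
      _ < η := hδη

end Joint

/-! ### From generic joint seminorms to isometries -/

section JointIsometry

variable {Y : Type u} [NormedAddCommGroup Y] [NormedSpace ℝ Y]
  {G : Type v} [NormedAddCommGroup G] [NormedSpace ℝ G]

theorem Joint.norm_sub_le (φ : Joint Y G) (y : Y) (g g' : G) :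
    ‖g - g'‖ ≤ φ.1 (y, -g) + φ.1 (y, -g') := by
  have h := map_sub_le_add (Joint.seminorm φ) (y, -g') (y, -g)
  have e : ((y, -g') : Y × G) - (y, -g) = (0, g - g') := by
    ext <;> simp [neg_add_eq_sub]
  rw [e, add_comm] at h
  exact (φ.2.2.2.2 (g - g')).symm.le.trans h

/-- Vectors of `G` ever closer to `y` are close to each other by `Joint.norm_sub_le`, so they form a
Cauchy sequence, and its limit is at distance zero from `y`. -/
theorem Joint.exists_eq_zero [CompleteSpace G] (φ : Joint Y G) (y : Y)
    (h : ∀ ε : ℝ, 0 < ε → ∃ g : G, φ.1 (y, -g) < ε) : ∃ g : G, φ.1 (y, -g) = 0 := by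
  have hb : Tendsto (fun n : ℕ => 1 / ((n : ℝ) + 1)) atTop (𝓝 0) :=
    tendsto_one_div_add_atTop_nhds_zero_nat
  choose g hg using fun n : ℕ => h (1 / ((n : ℝ) + 1)) Nat.one_div_pos_of_nat
  have hc : CauchySeq g := by
    refine cauchySeq_of_le_tendsto_0 (fun n : ℕ => 1 / ((n : ℝ) + 1) + 1 / ((n : ℝ) + 1)) ?_
      (by simpa using hb.add hb)
    intro n m N hn hm
    rw [dist_eq_norm]
    refine (Joint.norm_sub_le φ y _ _).trans (add_le_add ((hg n).le.trans ?_) ((hg m).le.trans ?_))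
    all_goals exact Nat.one_div_le_one_div (by assumption)
  obtain ⟨a, ha⟩ := cauchySeq_tendsto_of_complete hc
  refine ⟨a, le_antisymm ?_ (apply_nonneg (Joint.seminorm φ) _)⟩
  have hlim : Tendsto (fun n : ℕ => 1 / ((n : ℝ) + 1) + ‖g n - a‖) atTop (𝓝 0) := by
    simpa using hb.add (tendsto_iff_norm_sub_tendsto_zero.1 ha)
  refine ge_of_tendsto' hlim fun n => ?_
  have e : ((y, -a) : Y × G) = (y, -g n) + (0, g n - a) := by
    ext
    · simp
    · simp only [Prod.snd_add]; abel
  rw [e]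
  refine (φ.2.1 _ _).trans ?_
  rw [φ.2.2.2.2]
  linarith [hg n]

/-- `T y` is the only vector of `G` at `φ`-distance zero from `y`. Linearity follows from this
uniqueness, and `‖T y‖ = ‖y‖` because `φ` cannot separate `(y, 0)` from `(0, T y)`. -/
theorem Joint.exists_linearIsometry [CompleteSpace G] (φ : Joint Y G)
    (h : ∀ y, ∀ ε : ℝ, 0 < ε → ∃ g : G, φ.1 (y, -g) < ε) :
    ∃ T : Y →ₗᵢ[ℝ] G, ∀ y g, φ.1 (y, -g) = 0 → T y = g := by
  choose T hT using fun y => Joint.exists_eq_zero φ y (h y)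
  have huniq : ∀ y g, φ.1 (y, -g) = 0 → T y = g := fun y g hg => by
    have := Joint.norm_sub_le φ y (T y) g
    rw [hT, hg, add_zero] at this
    exact sub_eq_zero.1 (norm_le_zero_iff.1 this)
  have hnn : ∀ x, 0 ≤ φ.1 x := fun x => apply_nonneg (Joint.seminorm φ) x
  refine ⟨{ toFun := T, map_add' := fun x y => ?_, map_smul' := fun c x => ?_,
            norm_map' := fun x => ?_ }, huniq⟩
  · refine huniq _ _ (le_antisymm ?_ (hnn _))
    have e : ((x + y, -(T x + T y)) : Y × G) = (x, -T x) + (y, -T y) := by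
      ext <;> simp [add_comm]
    rw [e]
    exact (φ.2.1 _ _).trans (by rw [hT, hT, add_zero])
  · refine huniq _ _ ?_
    have e : ((c • x, -(c • T x)) : Y × G) = c • (x, -T x) := by ext <;> simp
    simp only [RingHom.id_apply]
    rw [e, φ.2.2.1, hT, mul_zero]
  · have := abs_sub_map_le_sub (Joint.seminorm φ) (x, 0) (0, T x)
    have e : ((x, 0) : Y × G) - (0, T x) = (x, -T x) := by ext <;> simp
    rw [e] at this
    simp only [Joint.seminorm_apply] at this
    rw [hT, φ.2.2.2.1, φ.2.2.2.2] at this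
    exact (sub_eq_zero.1 (abs_nonpos_iff.1 this)).symm

theorem Joint.exists_lt_of_dense (φ : Joint Y G) {s : Set Y} (hs : Dense s)
    (h : ∀ y ∈ s, ∀ n : ℕ, φ ∈ Joint.near G y (1 / ((n : ℝ) + 1))) (y : Y) (ε : ℝ) (hε : 0 < ε) :
    ∃ g : G, φ.1 (y, -g) < ε := by
  obtain ⟨y', hy', hyy'⟩ := hs.exists_dist_lt y (half_pos hε)
  obtain ⟨n, hn⟩ := exists_nat_one_div_lt (half_pos hε)
  obtain ⟨g, hg⟩ := h y' hy' n
  refine ⟨g, ?_⟩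
  have e : ((y, -g) : Y × G) = (y - y', 0) + (y', -g) := by ext <;> simp
  rw [e]
  refine (φ.2.1 _ _).trans_lt ?_
  rw [φ.2.2.2.1, ← dist_eq_norm]
  linarith

/-- Exchanging the two factors. -/
def Joint.swap (φ : Joint Y G) : Joint G Y :=
  ⟨fun x => φ.1 x.swap, fun x y => φ.2.1 x.swap y.swap, fun c x => φ.2.2.1 c x.swap, φ.2.2.2.2,
    φ.2.2.2.1⟩

theorem Joint.continuous_swap : Continuous (Joint.swap : Joint Y G → Joint G Y) :=
  Continuous.subtype_mk (continuous_pi fun x =>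
    (continuous_apply x.swap).comp continuous_subtype_val) _

/-- Exchanging the two factors, as a homeomorphism. -/
def Joint.swapHomeomorph (Y : Type u) [NormedAddCommGroup Y] [NormedSpace ℝ Y]
    (G : Type v) [NormedAddCommGroup G] [NormedSpace ℝ G] : Joint Y G ≃ₜ Joint G Y where
  toFun := Joint.swap
  invFun := Joint.swap
  left_inv _ := rfl
  right_inv _ := rfl
  continuous_toFun := Joint.continuous_swap
  continuous_invFun := Joint.continuous_swap

theorem Joint.swap_apply (φ : Joint Y G) (y : Y) (g : G) :
    (Joint.swap φ).1 (g, -y) = φ.1 (y, -g) := by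
  have h := φ.2.2.1 (-1) (y, -g)
  have e : (-1 : ℝ) • ((y, -g) : Y × G) = (-y, g) := by ext <;> simp
  rw [e, abs_neg, abs_one, one_mul] at h
  exact h

theorem IsGurarii.nonempty_linearIsometry [CompleteSpace G] (hG : IsGurarii G)
    [SeparableSpace Y] : Nonempty (Y →ₗᵢ[ℝ] G) := by
  obtain ⟨s, hs, hd⟩ := exists_countable_dense Y
  have := hs.to_subtype
  obtain ⟨φ, hφ⟩ := (dense_iInter_of_isOpen
    (f := fun i : s × ℕ => Joint.near G (i.1 : Y) (1 / ((i.2 : ℝ) + 1)))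
    (fun i => Joint.isOpen_near _ _)
    (fun i => Joint.dense_near hG _ Nat.one_div_pos_of_nat)).nonempty
  rw [Set.mem_iInter] at hφ
  obtain ⟨T, _⟩ := Joint.exists_linearIsometry φ
    (Joint.exists_lt_of_dense φ hd fun y hy n => hφ (⟨y, hy⟩, n))
  exact ⟨T⟩

/-- A Baire category form of back-and-forth: a generic `φ` brings `Y` close to `G` and `G` close to
`Y`. Each `g` is then at distance zero from some `y`, and uniqueness forces `T y = g`. -/
theorem IsGurarii.nonempty_linearIsometryEquiv [CompleteSpace G] [SeparableSpace G]
    (hG : IsGurarii G) [CompleteSpace Y] [SeparableSpace Y] (hY : IsGurarii Y) :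
    Nonempty (Y ≃ₗᵢ[ℝ] G) := by
  obtain ⟨s, hs, hd⟩ := exists_countable_dense Y
  obtain ⟨t, ht, htd⟩ := exists_countable_dense G
  have := hs.to_subtype
  have := ht.to_subtype
  obtain ⟨φ, hφ⟩ := (dense_iInter_of_isOpen
    (f := fun i : (s × ℕ) ⊕ (t × ℕ) => Sum.elim
      (fun i : s × ℕ => Joint.near G (i.1 : Y) (1 / ((i.2 : ℝ) + 1)))
      (fun i : t × ℕ => Joint.swapHomeomorph Y G ⁻¹'
        Joint.near Y (i.1 : G) (1 / ((i.2 : ℝ) + 1))) i)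
    (by
      rintro (i | i)
      · exact Joint.isOpen_near _ _
      · exact (Joint.isOpen_near _ _).preimage (Joint.swapHomeomorph Y G).continuous)
    (by
      rintro (i | i)
      · exact Joint.dense_near hG _ Nat.one_div_pos_of_nat
      · exact (Joint.dense_near hY _ Nat.one_div_pos_of_nat).preimage
          (Joint.swapHomeomorph Y G).isOpenMap)).nonempty
  rw [Set.mem_iInter] at hφ
  obtain ⟨T, hT⟩ := Joint.exists_linearIsometry φ
    (Joint.exists_lt_of_dense φ hd fun y hy n => hφ (Sum.inl (⟨y, hy⟩, n)))
  refine ⟨LinearIsometryEquiv.ofSurjective T fun g => ?_⟩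
  obtain ⟨y, hy⟩ := Joint.exists_eq_zero (Joint.swap φ) g
    (Joint.exists_lt_of_dense (Joint.swap φ) htd (fun g hg n => hφ (Sum.inr (⟨g, hg⟩, n))) g)
  exact ⟨y, hT y g (by rwa [Joint.swap_apply] at hy)⟩

end JointIsometry

/-! ### Continuous reductions of `G_δ` sets -/

section Hardness

/-- In a zero-dimensional second-countable space every open set is the cozero set of a continuous
function that is locally constant on it. -/
theorem exists_cozero_locallyConstant {T : Type*} [TopologicalSpace T]
    [SecondCountableTopology T] (hT : IsTopologicalBasis {U : Set T | IsClopen U}) {U : Set T}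
    (hU : IsOpen U) : ∃ φ : T → ℝ, Continuous φ ∧ (∀ t ∈ U, 0 < φ t) ∧ (∀ t ∉ U, φ t = 0) ∧
      ∀ t ∈ U, ∀ᶠ s in 𝓝 t, φ s = φ t := by
  classical
  obtain ⟨C, hC, hCU⟩ : ∃ C : ℕ → Set T, (∀ n, IsClopen (C n)) ∧ U = ⋃ n, C n := by
    rcases U.eq_empty_or_nonempty with rfl | hne
    · exact ⟨fun _ => ∅, fun _ => isClopen_empty, by simp⟩
    · obtain ⟨S, hS, hSc, hSU⟩ : ∃ S : Set (Set T), (∀ V ∈ S, IsClopen V) ∧ S.Countable ∧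
          U = ⋃₀ S := by
        obtain ⟨S, hSb, hSU⟩ := hT.open_eq_sUnion hU
        obtain ⟨S', hS'c, hS'S, hS'⟩ := isOpen_sUnion_countable S
          (fun V hV => IsClopen.isOpen (hSb hV))
        exact ⟨S', fun V hV => hSb (hS'S hV), hS'c, by rw [hS', ← hSU]⟩
      have hSne : S.Nonempty := by
        rw [hSU] at hne
        obtain ⟨x, V, hV, _⟩ := hne
        exact ⟨V, hV⟩
      obtain ⟨C, hC⟩ := hSc.exists_eq_range hSne
      refine ⟨C, fun n => hS _ (hC ▸ Set.mem_range_self n), ?_⟩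
      rw [hSU, hC, Set.sUnion_range]
  have hex : ∀ t, t ∈ U ↔ ∃ n, t ∈ C n := fun t => by rw [hCU, Set.mem_iUnion]
  -- The first index `n` with `t ∈ C n` is locally constant on `U` because the `C n` are clopen. It
  -- tends to infinity at points outside `U`, which have neighbourhoods missing any given finite
  -- number of the `C n`.
  let φ : T → ℝ := fun t => if h : ∃ n, t ∈ C n then (1 / 2 : ℝ) ^ Nat.find h else 0
  have hφU : ∀ t (h : ∃ n, t ∈ C n), φ t = (1 / 2 : ℝ) ^ Nat.find h := fun t h => dif_pos h
  have hφ0 : ∀ t ∉ U, φ t = 0 := fun t ht => dif_neg (by rwa [← hex])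
  have hnn : ∀ t, 0 ≤ φ t := fun t => by
    by_cases h : ∃ n, t ∈ C n
    · rw [hφU t h]; positivity
    · exact (hφ0 t (by rwa [hex])).ge
  have hlc : ∀ t ∈ U, ∀ᶠ s in 𝓝 t, φ s = φ t := by
    intro t ht
    have h := (hex t).1 ht
    have h1 : ∀ᶠ s in 𝓝 t, s ∈ C (Nat.find h) := (hC _).isOpen.mem_nhds (Nat.find_spec h)
    have h2 : ∀ᶠ s in 𝓝 t, ∀ m ∈ Finset.range (Nat.find h), s ∉ C m := by
      rw [Filter.eventually_all_finset]
      intro m hm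
      exact (hC m).isClosed.isOpen_compl.mem_nhds (Nat.find_min h (Finset.mem_range.1 hm))
    filter_upwards [h1, h2] with s hs1 hs2
    rw [hφU t h, hφU s ⟨_, hs1⟩]
    congr 1
    rw [Nat.find_eq_iff]
    exact ⟨hs1, fun m hm => hs2 m (Finset.mem_range.2 hm)⟩
  refine ⟨φ, continuous_iff_continuousAt.2 fun t => ?_, fun t ht => ?_, hφ0, hlc⟩
  · by_cases ht : t ∈ U
    · exact (continuousAt_congr (hlc t ht)).2 continuousAt_const
    · rw [ContinuousAt, hφ0 t ht, Metric.tendsto_nhds]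
      intro ε hε
      obtain ⟨K, hK⟩ := exists_pow_lt_of_lt_one hε (by norm_num : (1 / 2 : ℝ) < 1)
      have h2 : ∀ᶠ s in 𝓝 t, ∀ m ∈ Finset.range K, s ∉ C m := by
        rw [Filter.eventually_all_finset]
        intro m _
        refine (hC m).isClosed.isOpen_compl.mem_nhds fun h => ht ?_
        exact (hex t).2 ⟨m, h⟩
      filter_upwards [h2] with s hs
      rw [Real.dist_eq, sub_zero, abs_of_nonneg (hnn s)]
      by_cases h : ∃ n, s ∈ C n
      · rw [hφU s h]
        refine lt_of_le_of_lt (pow_le_pow_of_le_one (by norm_num) (by norm_num) ?_) hK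
        rw [Nat.le_find_iff]
        exact fun m hm => hs m (Finset.mem_range.2 hm)
      · rwa [hφ0 s (by rwa [hex])]
  · rw [hφU t ((hex t).1 ht)]
    positivity

variable {T Y : Type*} [TopologicalSpace T] [SecondCountableTopology T] [MetricSpace Y]

/-- One step of the approximation of a reduction: a continuous map into `D` and a radius, both
locally constant on `U`. -/
structure IsApprox (D : Set Y) (U : Set T) (e : ℝ) (x : (T → Y) × (T → ℝ)) : Prop where
  continuous : Continuous x.1
  mem : ∀ t, x.1 t ∈ D
  locConst : ∀ t ∈ U, ∀ᶠ s in 𝓝 t, x.1 s = x.1 t ∧ x.2 s = x.2 t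
  pos : ∀ t ∈ U, 0 < x.2 t
  le : ∀ t ∈ U, x.2 t ≤ e

/-- On `U` the value moves to a nearby point of `D` with a closed ball inside the dense open set
`O`; off `U` nothing changes. -/
theorem IsApprox.exists_next (hT : IsTopologicalBasis {U : Set T | IsClopen U}) {D O : Set Y}
    (hD : Dense D) (hO : IsOpen O) (hOd : Dense O) {U U' : Set T} (hU : IsOpen U) (hU' : U' ⊆ U)
    {e e' : ℝ} (he' : 0 < e') {x : (T → Y) × (T → ℝ)} (hx : IsApprox D U e x) :
    ∃ x' : (T → Y) × (T → ℝ), IsApprox D U' e' x' ∧ (∀ t ∉ U, x'.1 t = x.1 t) ∧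
      (∀ t ∈ U, Metric.closedBall (x'.1 t) (x'.2 t) ⊆ Metric.closedBall (x.1 t) (x.2 t) ∩ O) ∧
      ∀ t ∈ U, dist (x.1 t) (x'.1 t) ≤ e := by
  classical
  have key : ∀ (y : Y) (ρ : ℝ), 0 < ρ → ∃ z : Y × ℝ, z.1 ∈ D ∧ dist y z.1 < ρ ∧ 0 < z.2 ∧
      z.2 ≤ e' ∧ Metric.closedBall z.1 z.2 ⊆ Metric.closedBall y ρ ∩ O := by
    intro y ρ hρ
    have hop : IsOpen (Metric.ball y ρ ∩ O) := Metric.isOpen_ball.inter hO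
    have hne : (Metric.ball y ρ ∩ O).Nonempty :=
      hOd.inter_open_nonempty _ Metric.isOpen_ball ⟨y, Metric.mem_ball_self hρ⟩
    obtain ⟨z, hz, hzD⟩ := hD.inter_open_nonempty _ hop hne
    obtain ⟨δ, hδ, hball⟩ := Metric.nhds_basis_closedBall.mem_iff.1 (hop.mem_nhds hz)
    refine ⟨(z, min δ e'), hzD, ?_, lt_min hδ he', min_le_right _ _, ?_⟩
    · rw [dist_comm]; exact hz.1
    · exact (Metric.closedBall_subset_closedBall (min_le_left _ _)).trans
        (hball.trans (Set.inter_subset_inter_left _ Metric.ball_subset_closedBall))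
  -- The choice depends only on the centre and the radius, so locally constant data produce locally
  -- constant data.
  choose! c hcD hcd hcpos hce hcb using key
  obtain ⟨φ, hφc, hφpos, hφ0, hφlc⟩ := exists_cozero_locallyConstant hT hU
  -- The bound by `φ`, which vanishes off `U`, makes the new map continuous at points outside `U`.
  let ρ : T → ℝ := fun t => min (x.2 t) (φ t)
  have hρ : ∀ t ∈ U, 0 < ρ t := fun t ht => lt_min (hx.pos t ht) (hφpos t ht)
  let f : T → Y := fun t => if t ∈ U then (c (x.1 t) (ρ t)).1 else x.1 t
  let r : T → ℝ := fun t => (c (x.1 t) (ρ t)).2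
  have hf : ∀ t ∈ U, f t = (c (x.1 t) (ρ t)).1 := fun t ht => if_pos ht
  have hf0 : ∀ t ∉ U, f t = x.1 t := fun t ht => if_neg ht
  have hlc : ∀ t ∈ U, ∀ᶠ s in 𝓝 t, f s = f t ∧ r s = r t := by
    intro t ht
    filter_upwards [hx.locConst t ht, hφlc t ht, hU.mem_nhds ht] with s h1 h2 h3
    have : ρ s = ρ t := by simp only [ρ, h1.2, h2]
    simp only [hf s h3, hf t ht, r, h1.1, this, and_self]
  have hdist : ∀ t ∈ U, dist (x.1 t) (f t) < ρ t := fun t ht => by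
    rw [hf t ht]
    exact hcd _ _ (hρ t ht)
  refine ⟨(f, r), ⟨?_, fun t => ?_, fun t ht => hlc t (hU' ht), fun t ht => ?_, fun t ht => ?_⟩,
    hf0, fun t ht => ?_, fun t ht => ?_⟩
  · rw [continuous_iff_continuousAt]
    intro t
    by_cases ht : t ∈ U
    · exact (continuousAt_congr ((hlc t ht).mono fun s hs => hs.1)).2 continuousAt_const
    · have h1 : ContinuousAt x.1 t := hx.continuous.continuousAt
      have h2 : Tendsto φ (𝓝 t) (𝓝 0) := hφ0 t ht ▸ hφc.continuousAt
      change Tendsto f (𝓝 t) (𝓝 (f t))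
      rw [hf0 t ht]
      refine tendsto_of_tendsto_of_dist h1 (squeeze_zero (fun _ => dist_nonneg) (fun s => ?_) h2)
      by_cases hs : s ∈ U
      · exact (hdist s hs).le.trans (min_le_right _ _)
      · rw [hf0 s hs, dist_self, hφ0 s hs]
  · by_cases ht : t ∈ U
    · change f t ∈ D
      rw [hf t ht]
      exact hcD _ _ (hρ t ht)
    · change f t ∈ D
      rw [hf0 t ht]
      exact hx.mem t
  · exact hcpos _ _ (hρ t (hU' ht))
  · exact hce _ _ (hρ t (hU' ht))
  · change Metric.closedBall (f t) (r t) ⊆ _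
    rw [hf t ht]
    refine (hcb _ _ (hρ t ht)).trans (Set.inter_subset_inter_left _ ?_)
    exact Metric.closedBall_subset_closedBall (min_le_left _ _)
  · exact ((hdist t ht).le.trans (min_le_left _ _)).trans (hx.le t ht)

/-- If `A` is a dense `G_δ` set and `D` is a dense set of a complete metric space, then each `G_δ`
subset of a zero-dimensional space can be continuously reduced to `A` with the complement going
to `D`. -/
theorem exists_continuous_reduction [Nonempty Y] [CompleteSpace Y]
    (hT : IsTopologicalBasis {U : Set T | IsClopen U}) {A D : Set Y} (hA : IsGδ A)
    (hAd : Dense A) (hD : Dense D) {S : Set T} (hS : IsGδ S) :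
    ∃ f : T → Y, Continuous f ∧ (∀ t ∈ S, f t ∈ A) ∧ ∀ t ∉ S, f t ∈ D := by
  obtain ⟨O, hO, rfl⟩ := isGδ_iff_eq_iInter_nat.1 hA
  obtain ⟨V, hV, rfl⟩ := isGδ_iff_eq_iInter_nat.1 hS
  have hOd : ∀ n, Dense (O n) := fun n => hAd.mono (Set.iInter_subset _ n)
  -- The sets decrease to `S`. A point of `S` is moved at every stage into nested balls inside `O
  -- n`; any other point leaves some `U n` and keeps its value in `D` from then on.
  let U : ℕ → Set T := fun n => ⋂ i ∈ Finset.range (n + 1), V i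
  have hU : ∀ n, IsOpen (U n) := fun n => isOpen_biInter_finset fun i _ => hV i
  have hUs : ∀ n, U (n + 1) ⊆ U n := fun n =>
    Set.biInter_subset_biInter_left fun i hi => by
      exact Finset.mem_range.2 ((Finset.mem_range.1 hi).trans (Nat.lt_succ_self _))
  have hUV : ∀ n, U n ⊆ V n := fun n => Set.biInter_subset_of_mem (by simp)
  let e : ℕ → ℝ := fun n => 1 / 2 / 2 ^ n
  have he : ∀ n, 0 < e n := fun n => by positivity
  obtain ⟨d, hd⟩ := hD.nonempty
  have h0 : IsApprox D (U 0) (e 0) (fun _ => d, fun _ => e 0) :=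
    ⟨continuous_const, fun _ => hd, fun _ _ => by simp, fun _ _ => he 0, fun _ _ => le_rfl⟩
  choose! F hF hF0 hFb hFd using fun (n : ℕ) (x : (T → Y) × (T → ℝ))
    (hx : IsApprox D (U n) (e n) x) =>
      hx.exists_next hT hD (hO n) (hOd n) (hU n) (hUs n) (he (n + 1))
  let x : ℕ → (T → Y) × (T → ℝ) := fun n => Nat.rec (fun _ => d, fun _ => e 0) F n
  have hx : ∀ n, IsApprox D (U n) (e n) (x n) := fun n => by
    induction n with
    | zero => exact h0
    | succ n ih => exact hF n _ ih
  have hx0 : ∀ n, ∀ t ∉ U n, (x (n + 1)).1 t = (x n).1 t := fun n => hF0 n _ (hx n)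
  have hxb : ∀ n, ∀ t ∈ U n, Metric.closedBall ((x (n + 1)).1 t) ((x (n + 1)).2 t) ⊆
      Metric.closedBall ((x n).1 t) ((x n).2 t) ∩ O n := fun n => hFb n _ (hx n)
  have hdist : ∀ t n, dist ((x n).1 t) ((x (n + 1)).1 t) ≤ 1 / 2 / 2 ^ n := fun t n => by
    by_cases ht : t ∈ U n
    · exact hFd n _ (hx n) t ht
    · rw [hx0 n t ht, dist_self]; positivity
  have hlim : ∀ t, ∃ y, Tendsto (fun n => (x n).1 t) atTop (𝓝 y) := fun t =>
    cauchySeq_tendsto_of_complete (cauchySeq_of_le_geometric_two (hdist t))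
  choose f hf using hlim
  have hfd : ∀ t n, dist ((x n).1 t) (f t) ≤ 1 / 2 ^ n := fun t n =>
    dist_le_of_le_geometric_two_of_tendsto (hdist t) (hf t) n
  refine ⟨f, ?_, fun t ht => ?_, fun t ht => ?_⟩
  · have hu : TendstoUniformly (fun n => (x n).1) f atTop := by
      rw [Metric.tendstoUniformly_iff]
      intro ε hε
      obtain ⟨K, hK⟩ := exists_pow_lt_of_lt_one hε (by norm_num : (1 / 2 : ℝ) < 1)
      filter_upwards [eventually_ge_atTop K] with n hn t
      rw [dist_comm]
      refine (hfd t n).trans_lt (lt_of_le_of_lt ?_ hK)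
      rw [one_div_pow]
      exact one_div_le_one_div_of_le (by positivity) (pow_le_pow_right₀ (by norm_num) hn)
    exact hu.continuous (Frequently.of_forall fun n => (hx n).continuous)
  · have htU : ∀ n, t ∈ U n := fun n => by
      simp only [U, Set.mem_iInter]
      exact fun i _ => Set.mem_iInter.1 ht i
    have hnest : ∀ n k, Metric.closedBall ((x (n + k)).1 t) ((x (n + k)).2 t) ⊆
        Metric.closedBall ((x n).1 t) ((x n).2 t) := fun n k => by
      induction k with
      | zero => exact subset_rfl
      | succ k ih => exact ((hxb (n + k) t (htU _)).trans Set.inter_subset_left).trans ih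
    rw [Set.mem_iInter]
    intro n
    refine (hxb n t (htU n) ?_).2
    refine Metric.isClosed_closedBall.mem_of_tendsto (hf t) ?_
    filter_upwards [eventually_ge_atTop (n + 1)] with m hm
    obtain ⟨k, rfl⟩ := Nat.exists_eq_add_of_le hm
    exact hnest (n + 1) k (Metric.mem_closedBall_self ((hx _).pos t (htU _)).le)
  · obtain ⟨n, hn⟩ : ∃ n, t ∉ U n := by
      by_contra! h
      exact ht (Set.mem_iInter.2 fun n => hUV n (h n))
    have hnk : ∀ k, t ∉ U (n + k) := fun k => by
      induction k with
      | zero => exact hn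
      | succ k ih => exact fun h => ih (hUs _ h)
    have hconst : ∀ k, (x (n + k)).1 t = (x n).1 t := fun k => by
      induction k with
      | zero => rfl
      | succ k ih => exact (hx0 (n + k) t (hnk k)).trans ih
    have : f t = (x n).1 t := by
      refine tendsto_nhds_unique (hf t) (tendsto_const_nhds.congr' ?_)
      filter_upwards [eventually_ge_atTop n] with m hm
      obtain ⟨k, rfl⟩ := Nat.exists_eq_add_of_le hm
      exact (hconst k).symm
    rw [this]
    exact (hx n).mem t

end Hardness

/-! ### Codes, coded spaces and the topology of `𝓟` -/

section Coding

/-- The canonical map of a seminormed space into its completion. -/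
noncomputable def completionMap (E : Type*) [SeminormedAddCommGroup E] [NormedSpace ℝ E] :
    E →ₗᵢ[ℝ] UniformSpace.Completion E :=
  UniformSpace.Completion.toComplₗᵢ

theorem denseRange_completionMap (E : Type*) [SeminormedAddCommGroup E] [NormedSpace ℝ E] :
    DenseRange (completionMap E) :=
  UniformSpace.Completion.denseRange_coe

theorem nonempty_completion_equiv {E : Type*} [SeminormedAddCommGroup E] [NormedSpace ℝ E]
    {Z : Type*} [NormedAddCommGroup Z] [NormedSpace ℝ Z] [CompleteSpace Z] (L : E →ₗᵢ[ℝ] Z)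
    (hd : DenseRange L) : Nonempty (UniformSpace.Completion E ≃ₗᵢ[ℝ] Z) := by
  let e : E →L[ℝ] UniformSpace.Completion E := UniformSpace.Completion.toComplL
  have he : DenseRange e := UniformSpace.Completion.denseRange_coe
  have hu : IsUniformInducing e := UniformSpace.Completion.isUniformInducing_coe E
  let f : UniformSpace.Completion E →L[ℝ] Z := L.toContinuousLinearMap.extend e
  have hf : ∀ x : E, f (e x) = L x := fun x => ContinuousLinearMap.extend_eq _ he hu x
  have hn : ∀ x, ‖f x‖ = ‖x‖ := fun x => by
    refine he.induction_on (p := fun x => ‖f x‖ = ‖x‖) x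
      (isClosed_eq f.continuous.norm continuous_norm) fun y => ?_
    rw [hf, L.norm_map]
    exact (UniformSpace.Completion.norm_coe y).symm
  let T : UniformSpace.Completion E →ₗᵢ[ℝ] Z := { toLinearMap := f.toLinearMap, norm_map' := hn }
  refine ⟨LinearIsometryEquiv.ofSurjective T fun z => ?_⟩
  have hc : IsClosed (Set.range T) := T.isometry.isClosedEmbedding.isClosed_range
  have hsub : Set.range L ⊆ Set.range T := by
    rintro _ ⟨x, rfl⟩
    exact ⟨e x, hf x⟩
  exact closure_minimal hsub hc (hd z)

/-- The canonical map of `c₀₀` into `X_μ`. -/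
noncomputable def toX (μ : Pseudonorm) : C00 →ₗ[ℝ] X μ :=
  (completionMap (PreSpace μ)).toLinearMap

theorem norm_toX (μ : Pseudonorm) (x : C00) : ‖toX μ x‖ = extend μ x :=
  (completionMap (PreSpace μ)).norm_map x

theorem denseRange_toX (μ : Pseudonorm) : DenseRange (toX μ) :=
  denseRange_completionMap (PreSpace μ)

theorem extend_le_weight (μ : Pseudonorm) (x : C00) : extend μ x ≤ weight μ x := by
  rw [extend_apply]
  refine (ciInf_le (extend_bddBelow μ x) 0).trans (le_of_eq ?_)
  rw [map_zero, map_zero, sub_zero, zero_add]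

/-- `L : c₀₀ → Z` is an isometry for `μ` with dense range, so that `Z` is a copy of `X_μ`. -/
structure IsCoding (μ : Pseudonorm) {Z : Type*} [NormedAddCommGroup Z] [NormedSpace ℝ Z]
    (L : C00 →ₗ[ℝ] Z) : Prop where
  norm_eq : ∀ x, ‖L x‖ = extend μ x
  dense : DenseRange L

theorem isCoding_toX (μ : Pseudonorm) : IsCoding μ (toX μ) := ⟨norm_toX μ, denseRange_toX μ⟩

section IsCoding

variable {μ : Pseudonorm} {Z : Type*} [NormedAddCommGroup Z] [NormedSpace ℝ Z] {L : C00 →ₗ[ℝ] Z}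

theorem IsCoding.norm_castV (hL : IsCoding μ L) (v : V) : ‖L (castV v)‖ = μ v := by
  rw [hL.norm_eq, extend_castV]

theorem IsCoding.exists_norm_sub_lt (hL : IsCoding μ L) (x : Z) {ε : ℝ} (hε : 0 < ε) :
    ∃ v : V, ‖x - L (castV v)‖ < ε := by
  obtain ⟨y, hy⟩ := hL.dense.exists_dist_lt x (half_pos hε)
  obtain ⟨v, hv⟩ := exists_weight_lt μ y (ε / 2) (half_pos hε)
  refine ⟨v, ?_⟩
  have h1 : ‖L y - L (castV v)‖ < ε / 2 := by
    rw [← map_sub, hL.norm_eq]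
    exact (extend_le_weight μ _).trans_lt hv
  rw [dist_eq_norm] at hy
  linarith [norm_sub_le_norm_sub_add_norm_sub x (L y) (L (castV v))]

theorem IsCoding.separableSpace (hL : IsCoding μ L) : SeparableSpace Z := by
  refine ⟨Set.range fun v : V => L (castV v), Set.countable_range _, fun x => ?_⟩
  rw [Metric.mem_closure_iff]
  intro ε hε
  obtain ⟨v, hv⟩ := hL.exists_norm_sub_lt x hε
  exact ⟨_, ⟨v, rfl⟩, by rwa [dist_eq_norm]⟩

theorem IsCoding.nonempty_equiv (hL : IsCoding μ L) [CompleteSpace Z] :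
    Nonempty (X μ ≃ₗᵢ[ℝ] Z) := by
  let L₀ : PreSpace μ →ₗᵢ[ℝ] Z := ⟨L, hL.norm_eq⟩
  exact nonempty_completion_equiv L₀ hL.dense

end IsCoding

instance (μ : Pseudonorm) : SeparableSpace (X μ) := (isCoding_toX μ).separableSpace

theorem castV_smul (q : ℚ) (v : V) : castV (q • v) = (q : ℝ) • castV v := by
  ext i; simp [castV]

theorem castV_single (i : ℕ) (q : ℚ) : castV (Finsupp.single i q) = Finsupp.single i (q : ℝ) := by
  simp [castV]

/-- The restriction to `V` of a seminorm on `c₀₀`. -/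
noncomputable def ofReal (p : Seminorm ℝ C00) : Pseudonorm :=
  Seminorm.of (fun v => p (castV v)) (fun v w => by rw [map_add]; exact map_add_le_add p _ _)
    (fun q v => by
      rw [castV_smul, map_smul_eq_mul]
      rfl)

theorem ofReal_apply (p : Seminorm ℝ C00) (v : V) : ofReal p v = p (castV v) := rfl

theorem extend_ofReal (p : Seminorm ℝ C00) : extend (ofReal p) = p :=
  (extend_unique (ofReal p) p fun _ => rfl).symm

/-- Infinite dimension is automatic, since `c₀₀` embeds in `X μ`. -/
theorem mem_B_of_extend_eq_zero {μ : Pseudonorm} (h : ∀ x : C00, extend μ x = 0 → x = 0) :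
    μ ∈ B := by
  refine ⟨fun hfin => ?_, h⟩
  have hinj : Function.Injective (toX μ) := by
    rw [injective_iff_map_eq_zero]
    intro x hx
    exact h x (by rw [← norm_toX, hx, norm_zero])
  have : Module.Finite ℝ (X μ) := hfin
  have := Module.Finite.of_injective (toX μ) hinj
  rw [Module.finite_finsupp_iff] at this
  rcases this with h | h | h
  · exact h.elim 0
  · exact not_subsingleton ℝ h
  · exact not_finite_iff_infinite.2 inferInstance h.2

/-! ### Topology of the space of pseudonorms -/

theorem isClosedEmbedding_pseudonorm :
    IsClosedEmbedding (fun (μ : Pseudonorm) (v : V) => μ v) := by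
  refine ⟨⟨⟨rfl⟩, DFunLike.coe_injective⟩, ?_⟩
  have : Set.range (fun (μ : Pseudonorm) (v : V) => μ v) =
      {φ | (∀ v w, φ (v + w) ≤ φ v + φ w) ∧ ∀ (q : ℚ) v, φ (q • v) = ‖q‖ * φ v} := by
    ext φ
    constructor
    · rintro ⟨μ, rfl⟩
      exact ⟨map_add_le_add μ, map_smul_eq_mul μ⟩
    · rintro ⟨h1, h2⟩
      exact ⟨Seminorm.of φ h1 h2, rfl⟩
  rw [this]
  simp only [Set.ofPred_and, Set.ofPred_forall]
  refine IsClosed.inter ?_ ?_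
  · exact isClosed_iInter fun x => isClosed_iInter fun y => isClosed_le (by fun_prop) (by fun_prop)
  · exact isClosed_iInter fun x => isClosed_iInter fun y => isClosed_eq (by fun_prop) (by fun_prop)

instance : PolishSpace Pseudonorm := isClosedEmbedding_pseudonorm.polishSpace

instance : Nonempty Pseudonorm := ⟨ofReal 0⟩

theorem continuous_eval (v : V) : Continuous fun μ : Pseudonorm => μ v :=
  (continuous_apply v).comp isClosedEmbedding_pseudonorm.continuous

/-- The `ℓ₁`-norm on `c₀₀`. -/
noncomputable def ell : Seminorm ℝ C00 :=
  Seminorm.of (fun x => x.sum fun _ r => |r|)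
    (fun x y => by
      classical
      have h0 : ∀ i ∈ x.support ∪ y.support, |(0 : ℝ)| = 0 := by simp
      rw [Finsupp.sum_of_support_subset (x + y) Finsupp.support_add _ h0,
        Finsupp.sum_of_support_subset x Finset.subset_union_left _ h0,
        Finsupp.sum_of_support_subset y Finset.subset_union_right _ h0, ← Finset.sum_add_distrib]
      exact Finset.sum_le_sum fun i _ => abs_add_le _ _)
    (fun c x => by
      rw [Finsupp.sum_smul_index' (by simp), Finsupp.sum, Finsupp.sum, Finset.mul_sum]
      exact Finset.sum_congr rfl fun i _ => by rw [smul_eq_mul, abs_mul, Real.norm_eq_abs])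

theorem ell_apply (x : C00) : ell x = x.sum fun _ r => |r| := rfl

theorem abs_le_ell (x : C00) (i : ℕ) : |x i| ≤ ell x := by
  rw [ell_apply]
  by_cases hi : i ∈ x.support
  · exact Finset.single_le_sum (f := fun i => |x i|) (fun _ _ => abs_nonneg _) hi
  · rw [Finsupp.notMem_support_iff.1 hi, abs_zero]
    exact Finset.sum_nonneg fun _ _ => abs_nonneg _

theorem eq_zero_of_ell_eq_zero {x : C00} (h : ell x = 0) : x = 0 := by
  ext i
  exact abs_nonpos_iff.1 ((abs_le_ell x i).trans h.le)

/-- A seminorm of a finite combination is bounded by the `ℓ₁`-norm of the coefficients. -/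
theorem seminorm_linearCombination_le {E : Type*} [AddCommGroup E] [Module ℝ E]
    (p : Seminorm ℝ E) (b : ℕ → E) {M : ℝ} (x : C00) (hb : ∀ i ∈ x.support, p (b i) ≤ M) :
    p (Finsupp.linearCombination ℝ b x) ≤ M * ell x := by
  rw [Finsupp.linearCombination_apply, ell_apply, Finsupp.sum, Finsupp.sum, Finset.mul_sum]
  refine (Finset.le_sum_of_subadditive p (map_zero p).le (map_add_le_add p) _ _).trans
    (Finset.sum_le_sum fun i hi => ?_)
  rw [map_smul_eq_mul, Real.norm_eq_abs, mul_comm]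
  exact mul_le_mul_of_nonneg_right (hb i hi) (abs_nonneg _)

theorem linearCombination_castV {E : Type*} [AddCommGroup E] [Module ℝ E] (b : ℕ → V)
    (L : C00 →ₗ[ℝ] E) (v : V) :
    L (castV (Finsupp.linearCombination ℚ b v)) =
      Finsupp.linearCombination ℝ (fun i => L (castV (b i))) (castV v) := by
  induction v using Finsupp.induction_linear with
  | zero => simp
  | add v w hv hw => simp only [map_add, hv, hw]
  | single i q =>
    rw [Finsupp.linearCombination_single, castV_smul, castV_single, map_smul,
      Finsupp.linearCombination_single]

theorem linearCombination_single_one (x : C00) :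
    Finsupp.linearCombination ℝ (fun i => (Finsupp.single i 1 : C00)) x = x := by
  simp [Finsupp.linearCombination_apply]

/-- The projection of `c₀₀` onto the first `n` coordinates. -/
noncomputable def proj (n : ℕ) : C00 →ₗ[ℝ] C00 :=
  Finsupp.linearCombination ℝ fun i => if i < n then Finsupp.single i 1 else 0

theorem linearCombination_congr {R E : Type*} [Semiring R] [AddCommMonoid E] [Module R E]
    {b b' : ℕ → E} {x : ℕ →₀ R} (h : ∀ i, x i ≠ 0 → b i = b' i) :
    Finsupp.linearCombination R b x = Finsupp.linearCombination R b' x := by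
  rw [Finsupp.linearCombination_apply, Finsupp.linearCombination_apply]
  refine Finset.sum_congr rfl fun i hi => ?_
  simp only [h i (Finsupp.mem_support_iff.1 hi)]

theorem proj_eq_self {n : ℕ} {x : C00} (hx : ∀ i, n ≤ i → x i = 0) : proj n x = x := by
  conv_rhs => rw [← linearCombination_single_one x]
  exact linearCombination_congr fun i hi => if_pos (not_le.1 fun h => hi (hx i h))

theorem proj_single {n i : ℕ} (r : ℝ) : proj n (Finsupp.single i r) =
    if i < n then Finsupp.single i r else 0 := by
  rw [proj, Finsupp.linearCombination_single]
  split_ifs <;> simp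

theorem proj_apply (n : ℕ) (x : C00) (i : ℕ) : proj n x i = if i < n then x i else 0 := by
  induction x using Finsupp.induction_linear with
  | zero => simp
  | add x y hx hy =>
    rw [map_add, Finsupp.add_apply, hx, hy, Finsupp.add_apply]
    split_ifs <;> simp
  | single j r =>
    rw [proj_single]
    by_cases h : j = i
    · subst h; split_ifs <;> simp
    · split_ifs <;> simp [Finsupp.single_eq_of_ne (Ne.symm h)]

/-- `V_n`: the vectors supported on the first `n` coordinates. -/
def Vn (n : ℕ) : Set V := {v | ∀ i, n ≤ i → v i = 0}

theorem exists_mem_Vn (s : Finset V) (n : ℕ) : ∃ m, n ≤ m ∧ ∀ v ∈ s, v ∈ Vn m := by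
  classical
  refine ⟨n + (s.biUnion fun v => v.support).sup id + 1, by omega, fun v hv i hi => ?_⟩
  by_contra h
  have : i ≤ (s.biUnion fun v => v.support).sup id :=
    Finset.le_sup (f := id) (Finset.mem_biUnion.2 ⟨v, hv, Finsupp.mem_support_iff.2 h⟩)
  omega

theorem castV_apply (v : V) (i : ℕ) : castV v i = (v i : ℝ) := by
  simp [castV]

theorem proj_castV {n : ℕ} {v : V} (hv : v ∈ Vn n) : proj n (castV v) = castV v :=
  proj_eq_self fun i hi => by rw [castV_apply, hv i hi, Rat.cast_zero]

theorem exists_castV_eq_proj (n : ℕ) (v : V) : ∃ w ∈ Vn n, castV w = proj n (castV v) := by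
  refine ⟨v.filter (· < n), fun i hi => Finsupp.filter_apply_neg _ _ (by simpa using hi), ?_⟩
  ext i
  rw [castV_apply, proj_apply, castV_apply, Finsupp.filter_apply]
  split_ifs <;> simp

/-- Pseudonorms that agree on `V_n` have extensions that agree on the first coordinates. -/
theorem extend_proj_congr {μ ν : Pseudonorm} {n : ℕ} (h : ∀ v ∈ Vn n, ν v = μ v) (x : C00) :
    extend ν (proj n x) = extend μ (proj n x) := by
  have : (extend ν).comp (proj n) = (extend μ).comp (proj n) := by
    rw [extend_unique (ofReal ((extend μ).comp (proj n))) ((extend ν).comp (proj n)),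
      extend_ofReal]
    intro v
    obtain ⟨w, hw, hwv⟩ := exists_castV_eq_proj n v
    rw [ofReal_apply, Seminorm.comp_apply, Seminorm.comp_apply, ← hwv, extend_castV, extend_castV,
      h w hw]
  exact congrFun (congrArg DFunLike.coe this) x

/-- A basic neighbourhood tests finitely many vectors, all of which lie in one `V_n`. -/
theorem dense_pseudonorm_of_approx {D : Set Pseudonorm}
    (h : ∀ (μ : Pseudonorm) (n : ℕ) (ε : ℝ), 0 < ε → ∃ ν ∈ D, ∀ v ∈ Vn n,
      |ν v - μ v| ≤ ε * ell (castV v)) : Dense D := by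
  refine dense_of_approx (fun (μ : Pseudonorm) (v : V) => μ v)
    isClosedEmbedding_pseudonorm.isInducing ?_
  intro μ s ε hε
  obtain ⟨n, -, hn⟩ := exists_mem_Vn s 0
  have hC : 0 < ∑ v ∈ s, ell (castV v) + 1 := by
    have : 0 ≤ ∑ v ∈ s, ell (castV v) := Finset.sum_nonneg fun v _ => apply_nonneg _ _
    positivity
  obtain ⟨ν, hν, hνv⟩ := h μ n (ε / (∑ v ∈ s, ell (castV v) + 1)) (div_pos hε hC)
  refine ⟨ν, hν, fun v hv => (hνv v (hn v hv)).trans_lt ?_⟩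
  rw [div_mul_eq_mul_div, div_lt_iff₀ hC]
  have := Finset.single_le_sum (f := fun v : V => ell (castV v)) (fun v _ => apply_nonneg _ _) hv
  exact mul_lt_mul_of_pos_left (by linarith) hε

end Coding

/-! ### Closeness of seminorms in finite dimension -/

section FiniteDimension

variable {F : Type*} [NormedAddCommGroup F] [NormedSpace ℝ F]

theorem exists_seminorm_le {ι : Type*} [Fintype ι] (b : Module.Basis ι ℝ F) :
    ∃ C : ℝ, 0 < C ∧ ∀ (p : Seminorm ℝ F) (M : ℝ), 0 ≤ M → (∀ i, p (b i) ≤ M) →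
      ∀ x, p x ≤ C * M * ‖x‖ := by
  have := Module.Basis.finiteDimensional_of_finite b
  let f : ι → (F →L[ℝ] ℝ) := fun i => LinearMap.toContinuousLinearMap (b.coord i)
  refine ⟨∑ i, ‖f i‖ + 1, by positivity, fun p M hM hp x => ?_⟩
  have h1 : p x ≤ ∑ i, |b.repr x i| * p (b i) := by
    conv_lhs => rw [← b.sum_repr x]
    refine (Finset.le_sum_of_subadditive p (map_zero p).le (map_add_le_add p) _ _).trans
      (Finset.sum_le_sum fun i _ => ?_)
    rw [map_smul_eq_mul, Real.norm_eq_abs]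
  have h2 : ∀ i, |b.repr x i| * p (b i) ≤ ‖f i‖ * ‖x‖ * M := fun i =>
    mul_le_mul ((f i).le_opNorm x) (hp i) (apply_nonneg _ _) (by positivity)
  calc p x ≤ ∑ i, ‖f i‖ * ‖x‖ * M := h1.trans (Finset.sum_le_sum fun i _ => h2 i)
    _ = (∑ i, ‖f i‖) * M * ‖x‖ := by
      rw [Finset.sum_mul, Finset.sum_mul]
      exact Finset.sum_congr rfl fun i _ => by ring
    _ ≤ (∑ i, ‖f i‖ + 1) * M * ‖x‖ := by gcongr; linarith

/-- Seminorms on a finite-dimensional space that are close on a suitable finite subset of a dense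
set are close on the unit ball. -/
theorem exists_finset_seminorm_close [FiniteDimensional ℝ F] {ι : Type*} [Fintype ι]
    (b : Module.Basis ι ℝ F) {D : Set F} (hD : Dense D) (hb : ∀ i, b i ∈ D) (p₀ : Seminorm ℝ F)
    {ε : ℝ} (hε : 0 < ε) : ∃ (s : Finset F) (η : ℝ), (s : Set F) ⊆ D ∧ 0 < η ∧
      ∀ p : Seminorm ℝ F, (∀ t ∈ s, |p t - p₀ t| ≤ η) → ∀ x, |p x - p₀ x| ≤ ε * ‖x‖ := by
  classical
  obtain ⟨C, hC, hCp⟩ := exists_seminorm_le b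
  let M : ℝ := ∑ i, p₀ (b i) + 1
  have hM : 0 < M := by
    have : 0 ≤ ∑ i, p₀ (b i) := Finset.sum_nonneg fun i _ => apply_nonneg _ _
    positivity
  have hpM : ∀ i, p₀ (b i) + 1 ≤ M := fun i => by
    have := Finset.single_le_sum (f := fun i => p₀ (b i)) (fun i _ => apply_nonneg _ _)
      (Finset.mem_univ i)
    simp only [M]; linarith
  let δ : ℝ := ε / (4 * (C * M))
  have hδ : 0 < δ := by positivity
  have hδe : C * M * δ = ε / 4 := by simp only [δ]; field_simp
  have : ProperSpace F := FiniteDimensional.proper_real F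
  obtain ⟨u, hu⟩ := (isCompact_sphere (0 : F) 1).elim_finite_subcover
    (fun t : D => Metric.ball (t : F) δ) (fun _ => Metric.isOpen_ball) (fun x _ => by
      obtain ⟨t, ht, hxt⟩ := hD.exists_dist_lt x hδ
      exact Set.mem_iUnion.2 ⟨⟨t, ht⟩, hxt⟩)
  -- The bound `1` at the basis vectors gives `p (b i) ≤ M`, so `p` and `p₀` share a Lipschitz
  -- constant; the bound `ε / 4` is used on a `δ`-net of the sphere.
  refine ⟨u.image Subtype.val ∪ Finset.univ.image b, min 1 (ε / 4), ?_, by positivity,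
    fun p hp => ?_⟩
  · intro t ht
    simp only [Finset.coe_union, Finset.coe_image, Set.mem_union, Set.mem_image] at ht
    rcases ht with ⟨t, _, rfl⟩ | ⟨i, _, rfl⟩
    · exact t.2
    · exact hb i
  · have hpb : ∀ i, p (b i) ≤ M := fun i => by
      have := hp (b i) (Finset.mem_union_right _ (Finset.mem_image_of_mem _ (Finset.mem_univ i)))
      linarith [(abs_le.1 this).2, hpM i, min_le_left 1 (ε / 4)]
    have hpx := hCp p M hM.le hpb
    have hp₀x := hCp p₀ M hM.le (fun i => by linarith [hpM i])
    have hsphere : ∀ x, ‖x‖ = 1 → |p x - p₀ x| ≤ ε := by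
      intro x hx
      obtain ⟨t, htu, hxt⟩ := Set.mem_iUnion₂.1
        (hu (by simpa using hx : x ∈ Metric.sphere (0 : F) 1))
      have h1 := hp t (Finset.mem_union_left _ (Finset.mem_image_of_mem _ htu))
      rw [Metric.mem_ball, dist_eq_norm] at hxt
      have h2 := (abs_sub_map_le_sub p x t).trans (hpx _)
      have h3 := (abs_sub_map_le_sub p₀ x t).trans (hp₀x _)
      have h4 : C * M * ‖x - t‖ ≤ ε / 4 := hδe ▸ mul_le_mul_of_nonneg_left hxt.le (by positivity)
      have h5 := min_le_right 1 (ε / 4)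
      rw [abs_le] at h1 h2 h3 ⊢
      constructor <;> linarith
    intro x
    rcases eq_or_ne x 0 with rfl | hx
    · simp
    · have hx' : 0 < ‖x‖ := norm_pos_iff.2 hx
      have h1 := hsphere (‖x‖⁻¹ • x) (by
        rw [norm_smul, norm_inv, norm_norm, inv_mul_cancel₀ hx'.ne'])
      rw [map_smul_eq_mul, map_smul_eq_mul, ← mul_sub, abs_mul, norm_inv, norm_norm,
        abs_of_pos (inv_pos.2 hx'), inv_mul_le_iff₀ hx'] at h1
      linarith

end FiniteDimension

/-! ### Open conditions on codes -/

section GDelta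

theorem apply_le_ell {ν : Pseudonorm} {M : ℝ} (h : ∀ i, ν (Finsupp.single i 1) ≤ M) (v : V) :
    ν v ≤ M * ell (castV v) := by
  rw [← extend_castV ν v]
  conv_lhs => rw [← linearCombination_single_one (castV v)]
  refine seminorm_linearCombination_le _ _ _ fun i _ => ?_
  have := h i
  rwa [← extend_castV, castV_single, Rat.cast_one] at this

theorem isCompact_bounded (M : ℝ) :
    IsCompact {ν : Pseudonorm | ∀ i, ν (Finsupp.single i 1) ≤ M} := by
  have hbox : IsCompact (Set.univ.pi fun v : V => Set.Icc (0 : ℝ) (M * ell (castV v))) :=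
    isCompact_univ_pi fun v => isCompact_Icc
  refine (isClosedEmbedding_pseudonorm.isCompact_preimage hbox).of_isClosed_subset ?_ ?_
  · simp only [Set.ofPred_forall]
    exact isClosed_iInter fun i => isClosed_le (continuous_eval _) continuous_const
  · intro ν hν v _
    exact ⟨apply_nonneg _ _, apply_le_ell hν v⟩

/-- The pseudonorms `μ` in which each pseudonorm `ν` that is bounded by `M` and agrees with `μ` on
`V_n` can be realized over `V_n` on the finite set `s` up to `ε`. -/
def Realizing (n : ℕ) (s : Finset V) (ε M : ℝ) : Set Pseudonorm :=
  {μ | ∀ ν : Pseudonorm, (∀ i, ν (Finsupp.single i 1) ≤ M) → (∀ v ∈ Vn n, ν v = μ v) →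
    ∃ b : ℕ → V, (∀ i < n, b i = Finsupp.single i 1) ∧
      ∀ v ∈ s, |μ (Finsupp.linearCombination ℚ b v) - ν v| < ε}

/-- The quantifier over `ν` ranges over a compact set, so it suffices to treat neighbourhoods of
each pair `(μ₀, ν)`. If `ν` agrees with `μ₀` on `V_n`, the same `b` works nearby; if not, the
disagreement persists nearby and the condition is vacuous. -/
theorem isOpen_realizing (n : ℕ) (s : Finset V) (ε M : ℝ) : IsOpen (Realizing n s ε M) := by
  rw [isOpen_iff_mem_nhds]
  intro μ₀ hμ₀
  refine (isCompact_bounded M).eventually_forall_of_forall_eventually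
    (P := fun μ ν : Pseudonorm => (∀ v ∈ Vn n, ν v = μ v) →
      ∃ b : ℕ → V, (∀ i < n, b i = Finsupp.single i 1) ∧
        ∀ v ∈ s, |μ (Finsupp.linearCombination ℚ b v) - ν v| < ε) fun ν hν => ?_
  by_cases h : ∀ v ∈ Vn n, ν v = μ₀ v
  · obtain ⟨b, hb, hbs⟩ := hμ₀ ν hν h
    have : ∀ᶠ z : Pseudonorm × Pseudonorm in 𝓝 (μ₀, ν),
        ∀ v ∈ s, |z.1 (Finsupp.linearCombination ℚ b v) - z.2 v| < ε := by
      rw [Filter.eventually_all_finset]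
      intro v hv
      refine (isOpen_lt ?_ continuous_const).mem_nhds (hbs v hv)
      exact (((continuous_eval _).comp continuous_fst).sub
        ((continuous_eval _).comp continuous_snd)).abs
    exact this.mono fun z hz _ => ⟨b, hb, hz⟩
  · push Not at h
    obtain ⟨v, hv, hne⟩ := h
    have : ∀ᶠ z : Pseudonorm × Pseudonorm in 𝓝 (μ₀, ν), z.2 v ≠ z.1 v :=
      (isOpen_ne_fun ((continuous_eval _).comp continuous_snd)
        ((continuous_eval _).comp continuous_fst)).mem_nhds hne
    exact this.mono fun z hz hz' => (hz (hz' v hv)).elim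

/-- The inclusion of `ℝⁿ` into `c₀₀`. -/
noncomputable def inc (n : ℕ) : (Fin n → ℝ) →ₗ[ℝ] C00 :=
  Fintype.linearCombination ℝ fun i => Finsupp.single (i : ℕ) 1

/-- The restriction of a sequence to its first `n` coordinates. -/
def restr (n : ℕ) : C00 →ₗ[ℝ] (Fin n → ℝ) where
  toFun x i := x i
  map_add' _ _ := rfl
  map_smul' _ _ := rfl

theorem inc_restr (n : ℕ) (x : C00) : inc n (restr n x) = proj n x := by
  ext j
  rw [inc, Fintype.linearCombination_apply, proj_apply, Finsupp.finsetSum_apply]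
  simp only [Finsupp.smul_single, smul_eq_mul, mul_one]
  split_ifs with h
  · rw [Finset.sum_eq_single ⟨j, h⟩]
    · exact Finsupp.single_eq_same
    · intro i _ hi
      exact Finsupp.single_eq_of_ne fun h' => hi (Fin.ext h'.symm)
    · simp
  · exact Finset.sum_eq_zero fun i _ => Finsupp.single_eq_of_ne fun h' => h (h' ▸ i.2)

theorem inc_ratCast {n : ℕ} (q : Fin n → ℚ) :
    inc n (fun i => (q i : ℝ)) = castV (∑ i : Fin n, Finsupp.single (i : ℕ) (q i)) := by
  rw [inc, Fintype.linearCombination_apply, map_sum]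
  exact Finset.sum_congr rfl fun i _ => by simp [castV_single]

theorem inc_injective (n : ℕ) : Function.Injective (inc n) := by
  have : ∀ x, restr n (inc n x) = x := fun x => by
    ext j
    change inc n x j = x j
    rw [inc, Fintype.linearCombination_apply, Finsupp.finsetSum_apply, Finset.sum_eq_single j]
    · simp
    · intro i _ hi
      rw [Finsupp.smul_single]
      exact Finsupp.single_eq_of_ne fun h' => hi (Fin.ext h'.symm)
    · simp
  exact Function.LeftInverse.injective this

theorem denseRange_ratCast_pi (n : ℕ) :
    DenseRange fun (q : Fin n → ℚ) (i : Fin n) => (q i : ℝ) :=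
  DenseRange.piMap fun _ => Rat.denseRange_cast

/-- The pseudonorms that are norms on the first `n` coordinates. -/
def NormOn (n : ℕ) : Set Pseudonorm :=
  {μ | ∃ c : ℝ, 0 < c ∧ ∀ x, c * ‖x‖ ≤ extend μ (inc n x)}

/-- A positive lower bound on the unit sphere of `ℝⁿ` survives, halved, when the values at finitely
many rational points change little. -/
theorem isOpen_normOn (n : ℕ) : IsOpen (NormOn n) := by
  rw [isOpen_iff_mem_nhds]
  rintro μ₀ ⟨c, hc, hcx⟩
  obtain ⟨s, η, hsD, hη, hs⟩ := exists_finset_seminorm_close (Pi.basisFun ℝ (Fin n))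
    (denseRange_ratCast_pi n) (fun i => ⟨Pi.single i 1, by
      ext j
      rw [Pi.basisFun_apply]
      by_cases h : j = i
      · subst h; simp
      · simp [h]⟩) ((extend μ₀).comp (inc n)) (half_pos hc)
  have : ∀ᶠ μ : Pseudonorm in 𝓝 μ₀, ∀ t ∈ s,
      |(extend μ).comp (inc n) t - (extend μ₀).comp (inc n) t| ≤ η := by
    rw [Filter.eventually_all_finset]
    intro t ht
    obtain ⟨q, rfl⟩ := hsD ht
    simp only [Seminorm.comp_apply, inc_ratCast, extend_castV]
    have hopen : IsOpen {μ : Pseudonorm | |μ (∑ i : Fin n, Finsupp.single (i : ℕ) (q i)) -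
        μ₀ (∑ i : Fin n, Finsupp.single (i : ℕ) (q i))| < η} :=
      isOpen_lt ((continuous_eval _).sub continuous_const).abs continuous_const
    filter_upwards [hopen.mem_nhds (by simpa using hη)] with μ hμ
    exact le_of_lt hμ
  refine this.mono fun μ hμ => ⟨c / 2, half_pos hc, fun x => ?_⟩
  have h1 := (abs_le.1 (hs _ hμ x)).1
  have h2 := hcx x
  rw [Seminorm.comp_apply, Seminorm.comp_apply] at h1
  linarith

theorem B_eq : B = ⋂ n, NormOn n := by
  ext μ
  rw [Set.mem_iInter]
  constructor
  · rintro ⟨-, h⟩ n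
    have hker : LinearMap.ker (toX μ ∘ₗ inc n) = ⊥ := by
      rw [LinearMap.ker_eq_bot']
      intro x hx
      have h1 := norm_toX μ (inc n x)
      rw [← LinearMap.comp_apply, hx, norm_zero] at h1
      exact inc_injective n ((h _ h1.symm).trans (map_zero _).symm)
    obtain ⟨K, hK, hKx⟩ := LinearMap.exists_antilipschitzWith _ hker
    refine ⟨(K : ℝ)⁻¹, by positivity, fun x => ?_⟩
    rw [inv_mul_le_iff₀ (by positivity)]
    have := hKx.le_mul_norm (map_zero _) x
    rwa [LinearMap.comp_apply, norm_toX] at this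
  · intro h
    refine mem_B_of_extend_eq_zero fun x hx => ?_
    obtain ⟨n, hn⟩ : ∃ n, ∀ i, n ≤ i → x i = 0 := by
      refine ⟨x.support.sup id + 1, fun i hi => ?_⟩
      by_contra h
      have : i ≤ x.support.sup id := Finset.le_sup (f := id) (Finsupp.mem_support_iff.2 h)
      omega
    obtain ⟨c, hc, hcx⟩ := h n
    have h1 := hcx (restr n x)
    rw [inc_restr, proj_eq_self hn, hx] at h1
    have h2 : ‖restr n x‖ = 0 := le_antisymm (nonpos_of_mul_nonpos_right h1 hc) (norm_nonneg _)
    rw [← proj_eq_self hn, ← inc_restr, norm_eq_zero.1 h2, map_zero]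

theorem isGδ_B : IsGδ B := by
  rw [B_eq]
  exact IsGδ.iInter fun n => (isOpen_normOn n).isGδ

end GDelta

/-! ### The Gurariĭ property in terms of `Realizing` -/

section GurariiCodes

theorem linearMap_eq_linearCombination {E : Type*} [AddCommGroup E] [Module ℝ E]
    (L : C00 →ₗ[ℝ] E) (x : C00) :
    L x = Finsupp.linearCombination ℝ (fun i => L (Finsupp.single i 1)) x := by
  conv_lhs => rw [← linearCombination_single_one x]
  rw [Finsupp.apply_linearCombination]
  rfl

theorem linearCombination_castV_eq_inl {E₁ E₂ : Type*} [AddCommGroup E₁] [Module ℝ E₁]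
    [AddCommGroup E₂] [Module ℝ E₂] (L : C00 →ₗ[ℝ] E₁) {c : ℕ → E₁ × E₂} {n : ℕ}
    (hc : ∀ i < n, c i = (L (Finsupp.single i 1), 0)) {v : V} (hv : v ∈ Vn n) :
    Finsupp.linearCombination ℝ c (castV v) = (L (castV v), 0) := by
  have : (L (castV v), (0 : E₂)) = (LinearMap.inl ℝ E₁ E₂ ∘ₗ L) (castV v) := rfl
  rw [this, linearMap_eq_linearCombination (LinearMap.inl ℝ E₁ E₂ ∘ₗ L)]
  refine linearCombination_congr fun i hi => ?_
  exact hc i (not_le.1 fun h => hi (by rw [castV_apply, hv i h, Rat.cast_zero]))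

theorem proj_proj {n m : ℕ} (h : n ≤ m) (x : C00) : proj m (proj n x) = proj n x :=
  proj_eq_self fun i hi => by rw [proj_apply, if_neg (by omega)]

variable {μ : Pseudonorm} {Z : Type*} [NormedAddCommGroup Z] [NormedSpace ℝ Z] {L : C00 →ₗ[ℝ] Z}

/-- The Gurariĭ property, applied to `ℝᵐ` seminormed by `ν` over its first `n` coordinates, almost
realizes `ν` in `Z`; the images of the remaining unit vectors are then moved to rational vectors. -/
theorem IsCoding.mem_realizing (hL : IsCoding μ L) (hZ : IsGurarii Z) (n : ℕ) (s : Finset V)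
    {ε : ℝ} (hε : 0 < ε) (M : ℝ) : μ ∈ Realizing n s ε M := by
  intro ν _ hνμ
  obtain ⟨m, hnm, hm⟩ := exists_mem_Vn s n
  let K : ℝ := ∑ i ∈ Finset.range n, ‖L (Finsupp.single i 1)‖
  have hK : 0 ≤ K := Finset.sum_nonneg fun _ _ => norm_nonneg _
  let C : ℝ := ∑ v ∈ s, ((K + 1) * ell (castV v) + ν v) + 1
  have hCs : ∀ v ∈ s, (K + 1) * ell (castV v) + ν v < C := fun v hv => by
    have := Finset.single_le_sum (f := fun v => (K + 1) * ell (castV v) + ν v)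
      (fun v _ => by positivity) hv
    simp only [C]; linarith
  have hC : 0 < C := by
    have : 0 ≤ ∑ v ∈ s, ((K + 1) * ell (castV v) + ν v) :=
      Finset.sum_nonneg fun v _ => by positivity
    positivity
  -- Moving the images of the unit vectors costs `δ * (K + 1) * ell (castV v)`, and the distortion
  -- of `f` costs `δ * ν v`.
  let δ : ℝ := ε / C
  have hδ : 0 < δ := div_pos hε hC
  have hδC : δ * C = ε := div_mul_cancel₀ _ hC.ne'
  obtain ⟨f, hf, hfj⟩ := hZ.exists_almost_isometry ((extend ν).comp (inc m))
    (restr m ∘ₗ proj n) (L ∘ₗ proj n) (fun x => by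
      rw [Seminorm.comp_apply, LinearMap.comp_apply, inc_restr, proj_proj hnm,
        extend_proj_congr hνμ, LinearMap.comp_apply, hL.norm_eq]) hδ
  let φ : C00 →ₗ[ℝ] Z := f ∘ₗ restr m
  choose c hc using fun i : ℕ => hL.exists_norm_sub_lt (φ (Finsupp.single i 1)) hδ
  let b : ℕ → V := fun i => if i < n then Finsupp.single i 1 else c i
  refine ⟨b, fun i hi => if_pos hi, fun v hv => ?_⟩
  have hb : ∀ i, ‖L (castV (b i)) - φ (Finsupp.single i 1)‖ ≤ δ * (K + 1) := fun i => by
    by_cases hi : i < n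
    · have h1 := hfj (Finsupp.single i 1)
      simp only [LinearMap.comp_apply, proj_single, if_pos hi] at h1
      simp only [b, if_pos hi, castV_single, Rat.cast_one]
      rw [norm_sub_rev]
      refine h1.trans (mul_le_mul_of_nonneg_left ?_ hδ.le)
      have := Finset.single_le_sum (f := fun i => ‖L (Finsupp.single i 1)‖)
        (fun i _ => norm_nonneg _) (Finset.mem_range.2 hi)
      simp only [K]; linarith
    · simp only [b, if_neg hi]
      rw [norm_sub_rev]
      exact (hc i).le.trans (le_mul_of_one_le_right hδ.le (by linarith))
  let ψ : C00 →ₗ[ℝ] Z := Finsupp.linearCombination ℝ (fun i => L (castV (b i))) - φ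
  have hψ : ‖ψ (castV v)‖ ≤ δ * (K + 1) * ell (castV v) := by
    rw [linearMap_eq_linearCombination ψ]
    refine seminorm_linearCombination_le (normSeminorm ℝ Z) _ _ fun i _ => ?_
    simpa [ψ] using hb i
  have h1 : |μ (Finsupp.linearCombination ℚ b v) - ‖φ (castV v)‖| ≤
      δ * (K + 1) * ell (castV v) := by
    rw [← hL.norm_castV, linearCombination_castV]
    exact (abs_norm_sub_norm_le _ _).trans hψ
  have h2 : |‖φ (castV v)‖ - ν v| ≤ δ * ν v := by
    have := abs_sub_le_of_almost_eq hδ (apply_nonneg _ _) (hf (restr m (castV v)))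
    rwa [Seminorm.comp_apply, inc_restr, proj_castV (hm v hv), extend_castV] at this
  calc |μ (Finsupp.linearCombination ℚ b v) - ν v|
      ≤ δ * (K + 1) * ell (castV v) + δ * ν v := (abs_sub_le _ _ _).trans (add_le_add h1 h2)
    _ = δ * ((K + 1) * ell (castV v) + ν v) := by ring
    _ < δ * C := mul_lt_mul_of_pos_left (hCs v hv) hδ
    _ = ε := hδC

theorem linearCombination_eq_self {n : ℕ} {b : ℕ → V} (hb : ∀ i < n, b i = Finsupp.single i 1)
    {v : V} (hv : v ∈ Vn n) : Finsupp.linearCombination ℚ b v = v := by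
  rw [linearCombination_congr (b' := fun i => Finsupp.single i 1)
    fun i hi => hb i (not_le.1 fun h => hi (hv i h))]
  simp [Finsupp.linearCombination_apply]

/-- The amalgam `N` of `Z` and `F` over `A` is coded by a pseudonorm `ν`: the first `n` coordinates
are those of `μ` and nearly contain a basis of `A`, the next `l` carry a basis of `F`. Realizing `ν`
over `V_n` places `F` in `Z` with `g a` close to `a`. -/
theorem IsCoding.isGurarii (hL : IsCoding μ L)
    (h : ∀ (n : ℕ) (s : Finset V) (k M : ℕ), μ ∈ Realizing n s (1 / ((k : ℝ) + 1)) M) :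
    IsGurarii Z := by
  classical
  intro ε hε F _ _ _ A g
  have : FiniteDimensional ℝ A := FiniteDimensional.of_injective g.toLinearMap g.injective
  let N := glue (normSeminorm ℝ Z) (normSeminorm ℝ F) A.subtype g.toLinearMap 0
  have hN₁ : ∀ x, N (x, 0) = ‖x‖ := glue_inl fun w => by simp
  have hN₂ : ∀ y, N (0, y) = ‖y‖ := glue_inr fun w => by simp
  have hN₃ : ∀ a : A, N (a, -g a) ≤ 0 := fun a => glue_diag_le a
  let bF := Module.finBasis ℝ F
  let l := Module.finrank ℝ F
  let bA := Module.finBasis ℝ A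
  obtain ⟨C, hC, hCp⟩ := exists_seminorm_le bA
  let u : (Fin l → ℚ) → F := fun q => bF.equivFun.symm fun i => (q i : ℝ)
  have hu : ∀ q, u q = ∑ i, (q i : ℝ) • bF i := fun q => bF.equivFun_symm_apply _
  have hud : DenseRange u := by
    have hc : Continuous bF.equivFun.symm := LinearMap.continuous_of_finiteDimensional
      bF.equivFun.symm.toLinearMap
    exact bF.equivFun.symm.surjective.denseRange.comp (denseRange_ratCast_pi l) hc
  -- This distortion is chosen because `1 - ε / (1 + ε) = (1 + ε)⁻¹`.
  have hε' : 0 < ε / (1 + ε) := by positivity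
  obtain ⟨s₀, η, hs₀, hη, hs₀p⟩ := exists_finset_seminorm_close bF hud (fun i =>
    ⟨Pi.single i 1, by
      rw [hu, Finset.sum_eq_single i]
      · simp
      · intro j _ hj
        simp [hj]
      · simp⟩) (normSeminorm ℝ F) hε'
  -- At a basis vector `a` of `A` the error `f (g a) - a` splits into parts of size `2ω` (rational
  -- approximation of `g a`), `3ω` (realization) and `ω` (approximation of `a` by a code).
  obtain ⟨ω, hω, hωη, hωC⟩ : ∃ ω > 0, ω ≤ η ∧ C * (6 * ω) ≤ ε :=
    ⟨min η (ε / (C * 6)), by positivity, min_le_left _ _, by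
      have := min_le_right η (ε / (C * 6))
      rw [le_div_iff₀ (by positivity)] at this
      linarith⟩
  choose v hv using fun i => hL.exists_norm_sub_lt (bA i : Z) hω
  choose q hq using fun i => hud.exists_dist_lt (g (bA i)) hω
  obtain ⟨n, -, hn⟩ := exists_mem_Vn (Finset.univ.image v) 0
  replace hn : ∀ i, v i ∈ Vn n := fun i => hn _ (Finset.mem_image_of_mem _ (Finset.mem_univ i))
  let σ : (Fin l → ℚ) → V := fun q => ∑ i : Fin l, Finsupp.single (n + (i : ℕ)) (q i)
  let c : ℕ → Z × F := fun i => if i < n then (L (Finsupp.single i 1), 0) else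
    if h : i - n < l then (0, bF ⟨i - n, h⟩) else 0
  let Λ : C00 →ₗ[ℝ] Z × F := Finsupp.linearCombination ℝ c
  have hΛ₁ : ∀ v ∈ Vn n, Λ (castV v) = (L (castV v), 0) := fun v hv =>
    linearCombination_castV_eq_inl L (fun i hi => if_pos hi) hv
  have hΛ₂ : ∀ q, Λ (castV (σ q)) = (0, u q) := fun q => by
    rw [map_sum, map_sum, hu]
    have : ((0 : Z), ∑ i, (q i : ℝ) • bF i) = LinearMap.inr ℝ Z F (∑ i, (q i : ℝ) • bF i) := rfl
    rw [this, map_sum]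
    refine Finset.sum_congr rfl fun i _ => ?_
    rw [castV_single, Finsupp.linearCombination_single, map_smul]
    congr 1
    have h1 : ¬ (n + (i : ℕ) < n) := by omega
    have h2 : n + (i : ℕ) - n = i := by omega
    simp only [c, if_neg h1, h2, i.2, dif_pos]
    rfl
  let ν : Pseudonorm := ofReal (N.comp Λ)
  have hν : ∀ v, ν v = N (Λ (castV v)) := fun v => rfl
  obtain ⟨M, hM⟩ := exists_nat_ge (∑ i ∈ Finset.range (n + l), N (c i))
  have hνM : ∀ i, ν (Finsupp.single i 1) ≤ M := fun i => by
    rw [hν, castV_single, Rat.cast_one, Finsupp.linearCombination_single, one_smul]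
    refine le_trans ?_ hM
    by_cases hi : i < n + l
    · exact Finset.single_le_sum (f := fun i => N (c i)) (fun i _ => apply_nonneg _ _)
        (Finset.mem_range.2 hi)
    · have h1 : ¬ i < n := by omega
      have h2 : ¬ i - n < l := by omega
      simp only [c, if_neg h1, dif_neg h2, map_zero]
      exact Finset.sum_nonneg fun _ _ => apply_nonneg _ _
  have hνμ : ∀ v ∈ Vn n, ν v = μ v := fun v hv => by
    rw [hν, hΛ₁ v hv, hN₁, hL.norm_castV]
  have hs₀' : ∀ t : F, ∃ q : Fin l → ℚ, t ∈ s₀ → u q = t := fun t => by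
    by_cases ht : t ∈ s₀
    · obtain ⟨q, hq⟩ := hs₀ ht
      exact ⟨q, fun _ => hq⟩
    · exact ⟨0, fun h => (ht h).elim⟩
  choose qt hqt using hs₀'
  obtain ⟨k, hk⟩ := exists_nat_one_div_lt hω
  -- The first family controls the norm on `F`; the second, of vectors that are nearly null for `ν`,
  -- forces `f ∘ g` to be close to the inclusion of `A`.
  obtain ⟨b, hb, hbs⟩ := h n (s₀.image (fun t => σ (qt t)) ∪
    Finset.univ.image fun i => σ (q i) - v i) k M ν hνM hνμ
  let f : F →ₗ[ℝ] Z := bF.constr ℝ fun i => L (castV (b (n + (i : ℕ))))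
  have hf : ∀ q, f (u q) = L (castV (Finsupp.linearCombination ℚ b (σ q))) := fun q => by
    rw [hu, map_sum, map_sum, map_sum, map_sum]
    refine Finset.sum_congr rfl fun i _ => ?_
    rw [Finsupp.linearCombination_single, castV_smul, map_smul, map_smul, Module.Basis.constr_basis]
  have hfn : ∀ y, |‖f y‖ - ‖y‖| ≤ ε / (1 + ε) * ‖y‖ := by
    refine hs₀p ((normSeminorm ℝ Z).comp f) fun t ht => ?_
    have h1 := hbs (σ (qt t)) (Finset.mem_union_left _ (Finset.mem_image_of_mem _ ht))
    rw [hν, hΛ₂, hN₂, hqt t ht, ← hL.norm_castV, ← hf, hqt t ht] at h1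
    exact (h1.le.trans hk.le).trans hωη
  have hε1 : ε / (1 + ε) ≤ 1 := by rw [div_le_one (by positivity)]; linarith
  refine ⟨f, fun x => ⟨?_, ?_⟩, fun a => ?_⟩
  · have h1 := (abs_le.1 (hfn x)).1
    have h2 : (1 + ε)⁻¹ = 1 - ε / (1 + ε) := by field_simp; ring
    rw [h2]; linarith
  · have h1 := (abs_le.1 (hfn x)).2
    have h2 : ε / (1 + ε) ≤ ε := div_le_self hε.le (by linarith)
    nlinarith [mul_le_mul_of_nonneg_right h2 (norm_nonneg x)]
  · let T : A →ₗ[ℝ] Z := f ∘ₗ g.toLinearMap - A.subtype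
    refine (hCp ((normSeminorm ℝ Z).comp T) (6 * ω) (by positivity) (fun i => ?_) a).trans
      (mul_le_mul_of_nonneg_right hωC (norm_nonneg _))
    change ‖f (g (bA i)) - (bA i : Z)‖ ≤ 6 * ω
    have h1 : ‖f (g (bA i) - u (q i))‖ ≤ 2 * ω := by
      have h2 := (abs_le.1 (hfn (g (bA i) - u (q i)))).2
      have h3 := hq i
      rw [dist_eq_norm] at h3
      nlinarith [mul_le_mul_of_nonneg_right hε1 (norm_nonneg (g (bA i) - u (q i)))]
    have h4 : N (Λ (castV (σ (q i) - v i))) ≤ 2 * ω := by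
      rw [map_sub, map_sub, hΛ₂, hΛ₁ _ (hn i)]
      have e : ((0 : Z), u (q i)) - (L (castV (v i)), 0) =
          ((bA i : Z) - L (castV (v i)), 0) - (0, g (bA i) - u (q i)) -
            ((bA i : Z), -g (bA i)) := by
        ext <;> simp
      rw [e]
      have h5 := map_sub_le_add N (((bA i : Z) - L (castV (v i)), 0) - (0, g (bA i) - u (q i)))
        ((bA i : Z), -g (bA i))
      have h6 := map_sub_le_add N ((bA i : Z) - L (castV (v i)), 0) (0, g (bA i) - u (q i))
      have h7 := hq i
      rw [dist_eq_norm] at h7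
      rw [hN₁, hN₂] at h6
      linarith [hN₃ (bA i), hv i]
    have h5 : ‖f (u (q i)) - L (castV (v i))‖ ≤ 3 * ω := by
      have h6 := hbs (σ (q i) - v i) (Finset.mem_union_right _
        (Finset.mem_image_of_mem _ (Finset.mem_univ i)))
      rw [hν, ← hL.norm_castV, map_sub (Finsupp.linearCombination ℚ b),
        linearCombination_eq_self hb (hn i), map_sub, map_sub, ← hf] at h6
      linarith [(abs_lt.1 h6).2]
    have e : f (g (bA i)) - (bA i : Z) = f (g (bA i) - u (q i)) +
        (f (u (q i)) - L (castV (v i))) - ((bA i : Z) - L (castV (v i))) := by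
      rw [map_sub]; abel
    rw [e]
    have h8 := norm_sub_le (f (g (bA i) - u (q i)) + (f (u (q i)) - L (castV (v i))))
      ((bA i : Z) - L (castV (v i)))
    have h9 := norm_add_le (f (g (bA i) - u (q i))) (f (u (q i)) - L (castV (v i)))
    linarith [hv i]

end GurariiCodes

/-! ### Density of the Gurariĭ codes and existence -/

section Existence

/-- One-step amalgamation: `ν` is realized over `V_n` in a pseudonorm that agrees with `μ` on
`V_N`. -/
theorem exists_amalgam {μ ν : Pseudonorm} {n N : ℕ} (hnN : n ≤ N) (h : ∀ v ∈ Vn n, ν v = μ v) :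
    ∃ μ' : Pseudonorm, (∀ v ∈ Vn N, μ' v = μ v) ∧ ∃ b : ℕ → V,
      (∀ i < n, b i = Finsupp.single i 1) ∧ ∀ v, μ' (Finsupp.linearCombination ℚ b v) = ν v := by
  let g := glue (extend μ) (extend ν) (proj n) (proj n) 0
  have hg₁ : ∀ x, g (x, 0) = extend μ x := glue_inl fun w => by
    simp [extend_proj_congr h]
  have hg₂ : ∀ x, g (0, x) = extend ν x := glue_inr fun w => by
    simp [extend_proj_congr h]
  have hg₃ : ∀ x, g (proj n x, -proj n x) ≤ 0 := fun x => glue_diag_le x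
  let c : ℕ → C00 × C00 := fun i =>
    if i < N then (Finsupp.single i 1, 0) else (0, Finsupp.single (i - N) 1)
  let Λ : C00 →ₗ[ℝ] C00 × C00 := Finsupp.linearCombination ℝ c
  -- In the new code the coordinates from `N` on carry a copy of `ν`. The first `n` unit vectors of
  -- that copy are at distance zero from those of `μ`, so the latter can replace them.
  let b : ℕ → V := fun i => if i < n then Finsupp.single i 1 else Finsupp.single (N + i) 1
  have hμ' : ∀ v, ofReal (g.comp Λ) v = g (Λ (castV v)) := fun v => rfl
  refine ⟨ofReal (g.comp Λ), fun v hv => ?_, b, fun i hi => if_pos hi, fun v => ?_⟩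
  · have hΛ : Λ (castV v) = (castV v, 0) :=
      linearCombination_castV_eq_inl LinearMap.id (fun i hi => if_pos hi) hv
    rw [hμ', hΛ, hg₁, extend_castV]
  · have hΛ : Λ (castV (Finsupp.linearCombination ℚ b v)) =
        (proj n (castV v), castV v - proj n (castV v)) := by
      let R : C00 →ₗ[ℝ] C00 × C00 := (proj n).prod (LinearMap.id - proj n)
      change _ = R (castV v)
      rw [linearMap_eq_linearCombination R, linearCombination_castV]
      refine linearCombination_congr fun i _ => ?_
      simp only [R, LinearMap.prod_apply, Function.prod_apply, LinearMap.sub_apply,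
        LinearMap.id_apply, proj_single, b]
      by_cases hi : i < n
      · have hi' : i < N := by omega
        simp only [if_pos hi, castV_single, Rat.cast_one, Λ, Finsupp.linearCombination_single,
          one_smul, c, if_pos hi', sub_self]
      · have hi' : ¬ N + i < N := by omega
        simp only [if_neg hi, castV_single, Rat.cast_one, Λ, Finsupp.linearCombination_single,
          one_smul, c, if_neg hi', sub_zero, Nat.add_sub_cancel_left]
    rw [hμ', hΛ, ← extend_castV ν v, ← hg₂]
    have h1 := abs_sub_map_le_sub g (proj n (castV v), castV v - proj n (castV v)) (0, castV v)
    have e : (proj n (castV v), castV v - proj n (castV v)) - ((0 : C00), castV v) =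
        (proj n (castV v), -proj n (castV v)) := by
      ext : 1
      · simp
      · simp only [Prod.snd_sub]; abel
    rw [e] at h1
    exact sub_eq_zero.1 (abs_nonpos_iff.1 (h1.trans (hg₃ _)))

theorem Vn_mono {n m : ℕ} (h : n ≤ m) : Vn n ⊆ Vn m := fun _ hv i hi => hv i (h.trans hi)

/-- Each further amalgamation leaves the pseudonorm unchanged on a `V_{N'}` that contains all
vectors realized so far. -/
theorem exists_amalgam_finset (μ : Pseudonorm) {n N : ℕ} (hnN : n ≤ N) (s : Finset V)
    (K : Finset Pseudonorm) (hK : ∀ ν ∈ K, ∀ v ∈ Vn n, ν v = μ v) :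
    ∃ (μ' : Pseudonorm) (N' : ℕ), N ≤ N' ∧ (∀ v ∈ Vn N, μ' v = μ v) ∧ ∀ ν ∈ K, ∃ b : ℕ → V,
      (∀ i < n, b i = Finsupp.single i 1) ∧ ∀ v ∈ s,
        Finsupp.linearCombination ℚ b v ∈ Vn N' ∧ μ' (Finsupp.linearCombination ℚ b v) = ν v := by
  classical
  induction K using Finset.induction_on with
  | empty => exact ⟨μ, N, le_rfl, fun _ _ => rfl, by simp⟩
  | insert ν K _ ih =>
    obtain ⟨μ₁, N₁, hN₁, hμ₁, hb₁⟩ := ih fun ν hν => hK ν (Finset.mem_insert_of_mem hν)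
    have hνμ₁ : ∀ v ∈ Vn n, ν v = μ₁ v := fun v hv => by
      rw [hμ₁ v (Vn_mono hnN hv), hK ν (Finset.mem_insert_self _ _) v hv]
    obtain ⟨μ₂, hμ₂, b, hb, hbν⟩ := exists_amalgam (hnN.trans hN₁) hνμ₁
    obtain ⟨N₂, hN₂, hs⟩ := exists_mem_Vn (s.image (Finsupp.linearCombination ℚ b)) N₁
    refine ⟨μ₂, N₂, hN₁.trans hN₂, fun v hv => ?_, fun ν' hν' => ?_⟩
    · rw [hμ₂ v (Vn_mono hN₁ hv), hμ₁ v hv]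
    · rcases Finset.mem_insert.1 hν' with rfl | hν'
      · exact ⟨b, hb, fun v hv => ⟨hs _ (Finset.mem_image_of_mem _ hv), hbν v⟩⟩
      · obtain ⟨b', hb', hbs⟩ := hb₁ ν' hν'
        refine ⟨b', hb', fun v hv => ⟨Vn_mono hN₂ (hbs v hv).1, ?_⟩⟩
        rw [hμ₂ _ (hbs v hv).1, (hbs v hv).2]

/-- By compactness finitely many `ν` approximate on `s`, up to `ε`, all those to be realized.
Amalgamating them beyond `max N n` preserves `μ` on `V_N`, and on `V_n` too, so the set of `ν` to be
realized stays the same. -/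
theorem dense_realizing (n : ℕ) (s : Finset V) {ε : ℝ} (hε : 0 < ε) (M : ℝ) :
    Dense (Realizing n s ε M) := by
  refine dense_pseudonorm_of_approx fun μ N δ hδ => ?_
  have hcomp : IsCompact ({ν : Pseudonorm | ∀ i, ν (Finsupp.single i 1) ≤ M} ∩
      {ν | ∀ v ∈ Vn n, ν v = μ v}) := by
    refine (isCompact_bounded M).inter_right ?_
    simp only [Set.ofPred_forall]
    exact isClosed_iInter fun v => isClosed_iInter fun _ =>
      isClosed_eq (continuous_eval v) continuous_const
  obtain ⟨K, hK, hcover⟩ := hcomp.elim_nhds_subcover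
    (fun ν => {ν' : Pseudonorm | ∀ v ∈ s, |ν v - ν' v| < ε}) (fun ν _ => by
      refine (Filter.eventually_all_finset s).2 fun v _ => ?_
      exact (isOpen_lt (continuous_const.sub (continuous_eval v)).abs continuous_const).mem_nhds
        (by simpa using hε))
  obtain ⟨μ', N', -, hμ', hb⟩ := exists_amalgam_finset μ (le_max_right N n) s K
    (fun ν hν => (hK ν hν).2)
  refine ⟨μ', fun ν hνM hνμ => ?_, fun v hv => ?_⟩
  · obtain ⟨ν', hν', hνν'⟩ := Set.mem_iUnion₂.1 (hcover ⟨hνM, fun v hv => by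
      rw [hνμ v hv, hμ' v (Vn_mono (le_max_right N n) hv)]⟩)
    obtain ⟨b, hbn, hbs⟩ := hb ν' hν'
    refine ⟨b, hbn, fun v hv => ?_⟩
    rw [(hbs v hv).2]
    exact hνν' v hv
  · rw [hμ' v (Vn_mono (le_max_left N n) hv), sub_self, abs_zero]
    positivity

theorem gurarii_codes_eq : {μ : Pseudonorm | IsGurarii (X μ)} =
    ⋂ i : ℕ × Finset V × ℕ × ℕ,
      Realizing i.1 i.2.1 (1 / ((i.2.2.1 : ℝ) + 1)) (i.2.2.2 : ℕ) := by
  ext μ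
  rw [Set.mem_iInter]
  exact ⟨fun h i => (isCoding_toX μ).mem_realizing h _ _ Nat.one_div_pos_of_nat _,
    fun h => (isCoding_toX μ).isGurarii fun n s k M => h (n, s, k, M)⟩

theorem isGδ_gurarii_codes : IsGδ {μ : Pseudonorm | IsGurarii (X μ)} := by
  rw [gurarii_codes_eq]
  exact IsGδ.iInter_of_isOpen fun i => isOpen_realizing _ _ _ _

theorem exists_isGurarii : ∃ (G : Type) (_ : NormedAddCommGroup G) (_ : NormedSpace ℝ G),
    CompleteSpace G ∧ SeparableSpace G ∧ IsGurarii G := by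
  have hd : Dense {μ : Pseudonorm | IsGurarii (X μ)} := by
    rw [gurarii_codes_eq]
    exact dense_iInter_of_isOpen (fun i => isOpen_realizing _ _ _ _)
      fun i => dense_realizing _ _ Nat.one_div_pos_of_nat _
  obtain ⟨μ, hμ⟩ := hd.nonempty
  exact ⟨X μ, inferInstance, inferInstance, inferInstance, inferInstance, hμ⟩

end Existence

/-! ### Dense classes of codes -/

section Density

/-- In a separable space each finite part of an infinite linearly independent sequence extends to
a linearly independent sequence with dense span. -/
theorem exists_linearIndependent_dense_span {Z : Type*} [NormedAddCommGroup Z] [NormedSpace ℝ Z]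
    [SeparableSpace Z] {z : ℕ → Z} (hz : LinearIndependent ℝ z) (n : ℕ) :
    ∃ b : ℕ → Z, (∀ i < n, b i = z i) ∧ LinearIndependent ℝ b ∧
      Dense (Submodule.span ℝ (Set.range b) : Set Z) := by
  -- Including all of `z` guarantees that the maximal independent subfamily `w` is infinite.
  let v : ℕ ⊕ ℕ → Z := Sum.elim z (denseSeq Z)
  let s : Set (ℕ ⊕ ℕ) := Sum.inl '' Set.Iio n
  have hs : LinearIndepOn ℝ v s := by
    choose κ _ hκ using fun x : s => x.2
    have hv : (fun x : s => v x) = z ∘ κ := funext fun x => by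
      rw [← hκ x]
      rfl
    change LinearIndependent ℝ fun x : s => v x
    rw [hv]
    exact hz.comp κ fun x y hxy => Subtype.ext (by rw [← hκ x, ← hκ y, hxy])
  obtain ⟨w, -, hsw, hspan, hw⟩ := exists_linearIndepOn_extension hs (Set.subset_univ s)
  rw [Set.image_univ] at hspan
  have hwinf : w.Infinite := by
    intro hfin
    have : FiniteDimensional ℝ (Submodule.span ℝ (v '' w)) :=
      FiniteDimensional.span_of_finite ℝ (hfin.image v)
    let z' : ℕ → Submodule.span ℝ (v '' w) := fun i => ⟨z i, hspan ⟨Sum.inl i, rfl⟩⟩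
    have hz' : LinearIndependent ℝ z' :=
      LinearIndependent.of_comp (Submodule.span ℝ (v '' w)).subtype hz
    exact not_finite_iff_infinite.2 inferInstance hz'.finite
  have hsfin : s.Finite := (Set.finite_Iio n).image _
  have : Infinite ↥(w \ s) := (hwinf.sdiff hsfin).to_subtype
  obtain ⟨e⟩ := nonempty_equiv_of_countable (α := ℕ) (β := ↥(w \ s))
  let c : ℕ → w := fun i => if h : i < n then ⟨Sum.inl i, hsw ⟨i, h, rfl⟩⟩ else
    ⟨e (i - n), (e (i - n)).2.1⟩
  have hc₁ : ∀ i, i < n → (c i : ℕ ⊕ ℕ) = Sum.inl i := fun i h => by simp only [c, dif_pos h]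
  have hc₂ : ∀ i, ¬ i < n → (c i : ℕ ⊕ ℕ) = e (i - n) := fun i h => by simp only [c, dif_neg h]
  have hinj : Function.Injective c := by
    intro i j hij
    have hij' := congrArg Subtype.val hij
    by_cases hi : i < n <;> by_cases hj : j < n
    · rw [hc₁ i hi, hc₁ j hj] at hij'
      exact Sum.inl_injective hij'
    · rw [hc₁ i hi, hc₂ j hj] at hij'
      exact ((e (j - n)).2.2 (hij' ▸ ⟨i, hi, rfl⟩)).elim
    · rw [hc₂ i hi, hc₁ j hj] at hij'
      exact ((e (i - n)).2.2 (hij'.symm ▸ ⟨j, hj, rfl⟩)).elim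
    · rw [hc₂ i hi, hc₂ j hj] at hij'
      have := e.injective (Subtype.ext hij')
      omega
  have hsurj : ∀ x ∈ w, ∃ i, (c i : ℕ ⊕ ℕ) = x := by
    intro x hx
    by_cases hxs : x ∈ s
    · obtain ⟨i, hi, rfl⟩ := hxs
      exact ⟨i, hc₁ i hi⟩
    · refine ⟨n + e.symm ⟨x, hx, hxs⟩, ?_⟩
      rw [hc₂ _ (by omega), Nat.add_sub_cancel_left, Equiv.apply_symm_apply]
  refine ⟨fun i => v (c i), fun i hi => ?_, LinearIndependent.comp hw c hinj, ?_⟩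
  · simp only [hc₁ i hi]
    rfl
  · refine (denseRange_denseSeq Z).mono ?_
    rintro _ ⟨i, rfl⟩
    have h1 : v (Sum.inr i) ∈ Submodule.span ℝ (v '' w) := hspan ⟨Sum.inr i, rfl⟩
    refine Submodule.span_mono ?_ h1
    rintro _ ⟨x, hx, rfl⟩
    obtain ⟨i, hi⟩ := hsurj x hx
    exact ⟨i, by simp only [hi]⟩

/-- Adding `ε * ell` turns the given code into a norm, whose space embeds in `Z`. The first `n`
image vectors are kept, and the others are replaced so that the sequence stays independent and its
span becomes dense in `Z`. -/
theorem IsometricallyUniversal.dense_codes {Z : Type*} [NormedAddCommGroup Z] [NormedSpace ℝ Z]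
    [CompleteSpace Z] [SeparableSpace Z] (hZ : IsometricallyUniversal Z) :
    Dense {μ : Pseudonorm | μ ∈ B ∧ Nonempty (X μ ≃ₗᵢ[ℝ] Z)} := by
  refine dense_pseudonorm_of_approx fun μ₀ n ε hε => ?_
  let p : Seminorm ℝ C00 := extend μ₀ + ε.toNNReal • ell
  have hp : ∀ x, p x = extend μ₀ x + ε * ell x := fun x => by
    change extend μ₀ x + (ε.toNNReal : ℝ) * ell x = _
    rw [Real.coe_toNNReal _ hε.le]
  obtain ⟨T⟩ := hZ (X (ofReal p))
  let R : C00 →ₗ[ℝ] Z := T.toLinearMap ∘ₗ toX (ofReal p)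
  have hR : ∀ x, ‖R x‖ = p x := fun x => by
    change ‖T (toX (ofReal p) x)‖ = p x
    rw [T.norm_map, norm_toX, extend_ofReal]
  have hRinj : ∀ x, R x = 0 → x = 0 := fun x hx => by
    have h1 := hR x
    rw [hx, norm_zero, hp] at h1
    refine eq_zero_of_ell_eq_zero (le_antisymm ?_ (apply_nonneg _ _))
    have h2 : ε * ell x ≤ 0 := by linarith [apply_nonneg (extend μ₀) x]
    exact nonpos_of_mul_nonpos_right h2 hε
  have hz : LinearIndependent ℝ fun i => R (Finsupp.single i 1) := by
    intro x y hxy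
    rw [← linearMap_eq_linearCombination, ← linearMap_eq_linearCombination] at hxy
    exact sub_eq_zero.1 (hRinj _ (by rw [map_sub, hxy, sub_self]))
  obtain ⟨b, hb, hbi, hbd⟩ := exists_linearIndependent_dense_span hz n
  let L : C00 →ₗ[ℝ] Z := Finsupp.linearCombination ℝ b
  let μ : Pseudonorm := ofReal ((normSeminorm ℝ Z).comp L)
  have hL : IsCoding μ L := by
    refine ⟨fun x => by rw [extend_ofReal]; rfl, ?_⟩
    rw [← Finsupp.range_linearCombination] at hbd
    exact hbd
  refine ⟨μ, ⟨mem_B_of_extend_eq_zero fun x hx => ?_, hL.nonempty_equiv⟩, fun v hv => ?_⟩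
  · rw [← hL.norm_eq, norm_eq_zero] at hx
    exact hbi (hx.trans (map_zero L).symm)
  · have h1 : μ v = p (castV v) := by
      rw [← hL.norm_castV, ← hR, linearMap_eq_linearCombination R]
      congr 1
      exact linearCombination_congr fun i hi =>
        hb i (not_le.1 fun h => hi (by rw [castV_apply, hv i h, Rat.cast_zero]))
    rw [h1, hp, extend_castV, add_sub_cancel_left, abs_of_nonneg (by positivity)]

/-- In `ℝ × ℝ` with the sup norm, `(1, 0) ± (0, 1)` both have norm `1`. Extending `a` to this plane
up to `1/4` would give a `b` with `‖b‖ ≥ 4/5` and `‖a ± b‖ ≤ 3/2 < 9/5`. -/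
theorem not_isGurarii_of_norm_add {Z : Type*} [NormedAddCommGroup Z] [NormedSpace ℝ Z] {a : Z}
    (ha : ‖a‖ = 1) (h : ∀ b : Z, 1 + ‖b‖ ≤ max ‖a + b‖ ‖a - b‖) : ¬ IsGurarii Z := by
  intro hZ
  obtain ⟨f, hf, hfa⟩ := hZ.exists_almost_isometry (normSeminorm ℝ (ℝ × ℝ))
    (LinearMap.inl ℝ ℝ ℝ) (LinearMap.toSpanSingleton ℝ Z a)
    (fun t => by simp [norm_smul, ha]) (by norm_num : (0 : ℝ) < 1 / 4)
  have h1 : ‖f (1, 0) - a‖ ≤ 1 / 4 := by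
    have := hfa 1
    simpa [ha] using this
  have h2 := (hf (0, 1)).1
  have h3 := (hf (1, 1)).2
  have h4 := (hf (1, -1)).2
  simp only [coe_normSeminorm, Prod.norm_def] at h2 h3 h4
  norm_num at h2 h3 h4
  have e1 : a + f (0, 1) = f (1, 1) - (f (1, 0) - a) := by
    have : f (1, 1) = f (1, 0) + f (0, 1) := by rw [← map_add]; simp
    rw [this]; abel
  have e2 : a - f (0, 1) = f (1, -1) - (f (1, 0) - a) := by
    have : f (1, -1) = f (1, 0) - f (0, 1) := by rw [← map_sub]; simp
    rw [this]; abel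
  have h5 := h (f (0, 1))
  rw [e1, e2] at h5
  rcases le_max_iff.1 h5 with h5 | h5
  · linarith [norm_sub_le (f (1, 1)) (f (1, 0) - a)]
  · linarith [norm_sub_le (f (1, -1)) (f (1, 0) - a)]

theorem IsCoding.not_isGurarii {μ : Pseudonorm} {Z : Type*} [NormedAddCommGroup Z]
    [NormedSpace ℝ Z] {L : C00 →ₗ[ℝ] Z} (hL : IsCoding μ L) {e : C00} (he : extend μ e = 1)
    (h : ∀ x, 1 + extend μ x ≤ max (extend μ (e + x)) (extend μ (e - x))) : ¬ IsGurarii Z := by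
  refine not_isGurarii_of_norm_add (a := L e) (by rw [hL.norm_eq, he]) fun b => ?_
  refine hL.dense.induction_on (p := fun b => 1 + ‖b‖ ≤ max ‖L e + b‖ ‖L e - b‖) b
    (isClosed_le (by fun_prop) (by fun_prop)) fun x => ?_
  rw [← map_add, ← map_sub, hL.norm_eq, hL.norm_eq, hL.norm_eq]
  exact h x

theorem ell_add_single {x : C00} {n : ℕ} {c : ℝ} (hx : 0 ≤ x n) (hc : 0 ≤ c) :
    ell (x + Finsupp.single n c) = ell x + c := by
  classical
  have h0 : ∀ i ∈ insert n x.support, |(0 : ℝ)| = 0 := by simp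
  have hsub : (x + Finsupp.single n c).support ⊆ insert n x.support := by
    refine Finsupp.support_add.trans (Finset.union_subset (Finset.subset_insert _ _) ?_)
    exact Finsupp.support_single_subset.trans (by simp)
  rw [ell_apply, ell_apply, Finsupp.sum_of_support_subset _ hsub _ h0,
    Finsupp.sum_of_support_subset x (Finset.subset_insert _ _) _ h0]
  have h1 : ∀ i, |(x + Finsupp.single n c) i| = |x i| + Finsupp.single n c i := fun i => by
    rw [Finsupp.add_apply]
    by_cases hi : i = n
    · subst hi
      rw [Finsupp.single_eq_same, abs_of_nonneg hx, abs_of_nonneg (add_nonneg hx hc)]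
    · rw [Finsupp.single_eq_of_ne hi, add_zero, add_zero]
  rw [Finset.sum_congr rfl fun i _ => h1 i, Finset.sum_add_distrib]
  congr 1
  rw [Finset.sum_eq_single_of_mem n (Finset.mem_insert_self _ _)
    fun i _ hi => Finsupp.single_eq_of_ne hi, Finsupp.single_eq_same]

theorem dense_not_isGurarii_codes : Dense {μ : Pseudonorm | μ ∈ B ∧ ¬ IsGurarii (X μ)} := by
  refine dense_pseudonorm_of_approx fun μ₀ n ε hε => ?_
  let p : Seminorm ℝ C00 := (extend μ₀).comp (proj n) + ε.toNNReal • ell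
  have hp : ∀ x, p x = extend μ₀ (proj n x) + ε * ell x := fun x => by
    change extend μ₀ (proj n x) + (ε.toNNReal : ℝ) * ell x = _
    rw [Real.coe_toNNReal _ hε.le]
  -- Coordinate `n` is the first one that `proj n` kills, so it spans an `ℓ₁`-summand for `p`; the
  -- factor `ε⁻¹` makes `p e = 1`.
  let e : C00 := Finsupp.single n ε⁻¹
  have hadd : ∀ x : C00, 0 ≤ x n → p (e + x) = 1 + p x := fun x hx => by
    rw [hp, hp, add_comm e x, map_add, proj_single, if_neg (lt_irrefl n), add_zero,
      ell_add_single hx (by positivity), mul_add, mul_inv_cancel₀ hε.ne']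
    ring
  refine ⟨ofReal p, ⟨mem_B_of_extend_eq_zero fun x hx => ?_,
    (isCoding_toX _).not_isGurarii (e := e) ?_ fun x => ?_⟩, fun v hv => ?_⟩
  · rw [extend_ofReal, hp] at hx
    refine eq_zero_of_ell_eq_zero (le_antisymm ?_ (apply_nonneg _ _))
    have h2 : ε * ell x ≤ 0 := by linarith [apply_nonneg (extend μ₀) (proj n x)]
    exact nonpos_of_mul_nonpos_right h2 hε
  · rw [extend_ofReal]
    simpa using hadd 0 le_rfl
  · rw [extend_ofReal]
    rcases le_total 0 (x n) with hx | hx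
    · exact le_max_of_le_left (hadd x hx).ge
    · refine le_max_of_le_right (le_of_eq ?_)
      have h1 := hadd (-x) (by simpa using hx)
      rw [← sub_eq_add_neg, map_neg_eq_map] at h1
      exact h1.symm
  · rw [ofReal_apply, hp, proj_castV hv, extend_castV, add_sub_cancel_left,
      abs_of_nonneg (by positivity)]

end Density

/-! ### Isometry classes: complexity, uniqueness, completeness -/

section Main

theorem exists_isGδ_preimage_val {Y : Type*} [TopologicalSpace Y] {I : Set Y} {s : Set I}
    (hs : IsGδ s) : ∃ O : Set Y, IsGδ O ∧ s = Subtype.val ⁻¹' O := by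
  obtain ⟨U, hU, rfl⟩ := isGδ_iff_eq_iInter_nat.1 hs
  choose O hO hOU using fun n => isOpen_induced_iff.1 (hU n)
  exact ⟨⋂ n, O n, IsGδ.iInter_of_isOpen hO, by simp only [Set.preimage_iInter, hOU]⟩

variable {G : Type*} [NormedAddCommGroup G] [NormedSpace ℝ G] [CompleteSpace G]

theorem IsGurarii.isometricallyUniversal (hG : IsGurarii G) : IsometricallyUniversal G :=
  fun _ _ _ _ _ => hG.nonempty_linearIsometry

variable [SeparableSpace G]

/-- By uniqueness of the separable Gurariĭ space, the class is the trace on `I` of one `G_δ` subset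
of `𝓟`. -/
theorem IsGurarii.isometryClass_eq (hG : IsGurarii G) (I : Set Pseudonorm) :
    isometryClass I G = Subtype.val ⁻¹' {μ : Pseudonorm | IsGurarii (X μ)} := by
  ext μ
  exact ⟨fun ⟨e⟩ => hG.of_equiv e.symm, fun h => hG.nonempty_linearIsometryEquiv h⟩

theorem IsGurarii.isGδ_isometryClass (hG : IsGurarii G) (I : Set Pseudonorm) :
    IsGδ (isometryClass I G) := by
  rw [hG.isometryClass_eq]
  exact isGδ_gurarii_codes.preimage continuous_subtype_val

theorem IsGurarii.dense_codes (hG : IsGurarii G) :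
    Dense (B ∩ {μ : Pseudonorm | IsGurarii (X μ)}) :=
  hG.isometricallyUniversal.dense_codes.mono fun _ hμ => ⟨hμ.1, hG.of_equiv hμ.2.some.symm⟩

theorem IsGurarii.nonempty_equiv_of_isGδ (hG : IsGurarii G) {Z : Type*} [NormedAddCommGroup Z]
    [NormedSpace ℝ Z] [CompleteSpace Z] [SeparableSpace Z] (hZ : IsometricallyUniversal Z)
    (hB : IsGδ (isometryClass B Z)) : Nonempty (Z ≃ₗᵢ[ℝ] G) := by
  obtain ⟨O, hO, hOZ⟩ := exists_isGδ_preimage_val hB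
  have hOd : Dense O := hZ.dense_codes.mono fun μ hμ => by
    have : (⟨μ, hμ.1⟩ : B) ∈ isometryClass B Z := hμ.2
    rw [hOZ] at this
    exact this
  obtain ⟨μ, hμO, hμB, hμG⟩ := (hOd.inter_of_Gδ hO (isGδ_B.inter isGδ_gurarii_codes)
    hG.dense_codes).nonempty
  have : (⟨μ, hμB⟩ : B) ∈ isometryClass B Z := by
    rw [hOZ]
    exact hμO
  obtain ⟨e⟩ : Nonempty (X μ ≃ₗᵢ[ℝ] Z) := this
  obtain ⟨e'⟩ := hG.nonempty_linearIsometryEquiv hμG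
  exact ⟨e.symm.trans e'⟩

theorem B_subset_PInf : B ⊆ PInf := fun _ h => h.1

theorem preimage_inclusion_isometryClass (Z : Type*) [NormedAddCommGroup Z] [NormedSpace ℝ Z] :
    Set.inclusion B_subset_PInf ⁻¹' isometryClass PInf Z = isometryClass B Z := rfl

/-- The reduction is built in the Polish space `𝓟`. Since both dense sets, of Gurariĭ and of
non-Gurariĭ codes, are taken inside `𝓑`, all its values lie in `𝓑`. -/
theorem IsGurarii.isGδHard_B (hG : IsGurarii G) : IsGδHard (isometryClass B G) := by
  intro T _ _ hT S hS
  let := upgradeIsCompletelyMetrizable Pseudonorm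
  obtain ⟨f, hf, hfS, hfSc⟩ := exists_continuous_reduction hT
    (isGδ_B.inter isGδ_gurarii_codes) hG.dense_codes dense_not_isGurarii_codes hS
  have hfB : ∀ t, f t ∈ B := fun t => by
    by_cases ht : t ∈ S
    · exact (hfS t ht).1
    · exact (hfSc t ht).1
  refine ⟨fun t => ⟨f t, hfB t⟩, hf.subtype_mk _, ?_⟩
  rw [hG.isometryClass_eq]
  ext t
  refine ⟨fun h => ?_, fun h => (hfS t h).2⟩
  by_contra ht
  exact (hfSc t ht).2 h

theorem IsGurarii.isGδHard_PInf (hG : IsGurarii G) : IsGδHard (isometryClass PInf G) := by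
  intro T _ _ hT S hS
  obtain ⟨f, hf, hfS⟩ := hG.isGδHard_B T hT S hS
  exact ⟨Set.inclusion B_subset_PInf ∘ f, (continuous_inclusion B_subset_PInf).comp hf, by
    rw [Set.preimage_comp, preimage_inclusion_isometryClass, hfS]⟩

end Main
end BanachCoding

theorem mainTheorem5 :
    -- the Gurariĭ space exists
    (∃ (G : Type) (_ : NormedAddCommGroup G) (_ : NormedSpace ℝ G),
      CompleteSpace G ∧ TopologicalSpace.SeparableSpace G ∧ BanachCoding.IsGurarii G) ∧
    ∀ (G : Type*) [NormedAddCommGroup G] [NormedSpace ℝ G] [CompleteSpace G]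
      [TopologicalSpace.SeparableSpace G], BanachCoding.IsGurarii G →
      -- it is isometrically universal and its isometry class is `G_δ`
      BanachCoding.IsometricallyUniversal G ∧
      IsGδ (BanachCoding.isometryClass BanachCoding.B G) ∧
      IsGδ (BanachCoding.isometryClass BanachCoding.PInf G) ∧
      -- and it is the only such separable Banach space
      (∀ (Z : Type*) [NormedAddCommGroup Z] [NormedSpace ℝ Z] [CompleteSpace Z]
        [TopologicalSpace.SeparableSpace Z], BanachCoding.IsometricallyUniversal Z →
        (IsGδ (BanachCoding.isometryClass BanachCoding.B Z) → Nonempty (Z ≃ₗᵢ[ℝ] G)) ∧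
        (IsGδ (BanachCoding.isometryClass BanachCoding.PInf Z) → Nonempty (Z ≃ₗᵢ[ℝ] G))) ∧
      -- its isometry class is `G_δ`-complete in both spaces
      BanachCoding.IsGδComplete (BanachCoding.isometryClass BanachCoding.B G) ∧
      BanachCoding.IsGδComplete (BanachCoding.isometryClass BanachCoding.PInf G) := by
  refine ⟨BanachCoding.exists_isGurarii, fun G _ _ _ _ hG => ⟨hG.isometricallyUniversal,
    hG.isGδ_isometryClass _, hG.isGδ_isometryClass _, fun Z _ _ _ _ hZ =>
      ⟨hG.nonempty_equiv_of_isGδ hZ, fun h => hG.nonempty_equiv_of_isGδ hZ ?_⟩,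
    ⟨hG.isGδ_isometryClass _, hG.isGδHard_B⟩, ⟨hG.isGδ_isometryClass _, hG.isGδHard_PInf⟩⟩⟩
  -- The class in `𝓑` is the trace of the class in `𝓟_∞`, so the second uniqueness statement reduces
  -- to the first.
  rw [← BanachCoding.preimage_inclusion_isometryClass]
  exact h.preimage (continuous_inclusion BanachCoding.B_subset_PInf)
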